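/- Manifolds, maps, differential forms and actions are of class $C^\infty$; manifolds are Hausdorff, finite-dimensional and without boundary. Let $(M,\omega,\eta)$ be a connected cosymplectic manifold: $\dim M=2n+1$, $\omega$ is a closed $2$-form and $\eta$ a closed $1$-form on $M$, and $\eta\wedge\omega^n$ vanishes nowhere. Let $\mathcal R$ be its Reeb vector field, which is characterized by $i_{\mathcal R}\omega=0$ and $\eta(\mathcal R)=1$. Let $G$ be a Lie group with Lie algebra $\mathfrak g$. For a smooth action $\phi:G\times M\to M$ and $\xi\in\mathfrak g$ let $\xi_M$ denote the infinitesimal generator, $\xi_M(x)=T_e\phi_x(\xi)$ with $\phi_x(g)=\phi_g(x)$. The action is cosymplectic if $\phi_g^*\omega=\omega$ and $\phi_g^*\eta=\eta$ for all $g\in G$. A cosymplectic action is Hamiltonian with $G$-equivariant momentum map $J$ if $J:M\to\mathfrak g^*$ is smooth, $i_{\xi_M}\omega=dJ_\xi$ for all $\xi\in\mathfrak g$, where $J_\xi(x)=\langle J(x),\xi\rangle$, and $J\circ\phi_g=\mathrm{Ad}^*_g\circ J$ for all $g\in G$, where $\mathrm{Ad}^*_g\mu=\mu\circ\mathrm{Ad}_{g^{-1}}$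 is the coadjoint representation. Let $\phi:G\times M\to M$ be a Hamiltonian cosymplectic action with $G$-equivariant momentum map $J$. Then for each $\xi\in\mathfrak g$ the function $\eta(\xi_M)$ is constant on $M$; denote its value by $c_\eta(\xi)$, so that $c_\eta\in\mathfrak g^*$, and let $\overleftarrow{c_\eta}$ be the left-invariant $1$-form on $G$ whose value at the identity is $c_\eta$. Suppose that $\mathcal R$ is complete, with flow $\Phi^{\mathcal R}:\mathbb R\times M\to M$, and that $\overleftarrow{c_\eta}$ is exact. (i) If $G$ is connected, there is a unique smooth function $f_\eta:G\to\mathbb R$ that is multiplicative, i.e. $f_\eta(gh)=f_\eta(g)+f_\eta(h)$ for all $g,h\in G$, and satisfies $df_\eta=\overleftarrow{c_\eta}$. (ii) Let $G$ be connected and $f_\eta$ as in (i), or let $G$ be arbitrary and $f_\eta:G\to\mathbb R$ any smooth multiplicative function with $df_\eta=\overleftarrow{c_\eta}$. Then $$\widetilde\phi_g(x)=\Phi^{\mathcal R}_{f_\eta(g^{-1})}(\phi_g(x)),\qquad g\in G,\ x\in M,$$ defines a Hamiltonian cosymplectic action of $G$ on $M$ with the same $G$-equivariant momentum map $J$, and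 its infinitesimal generators $\widetilde\xi_M$ satisfy $$\eta(\widetilde\xi_M)=0\qquad\text{for all }\xi\in\mathfrak g.$$ -/

import Mathlib

open scoped Manifold ContDiff

/- Manifolds are modelled on a finite-dimensional real vector space `E`, Lie groups on `F`;
all are smooth, that is of class `∞`, and without boundary. A `1`-form is a family of
continuous linear functionals on the tangent spaces, a `k`-form is a family of
continuous alternating maps. -/

noncomputable section Cosymplectic

variable {E : Type*} [NormedAddCommGroup E] [NormedSpace ℝ E]
  {M : Type*} [TopologicalSpace M] [ChartedSpace E M]
  {F : Type*} [NormedAddCommGroup F] [NormedSpace ℝ F]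
  {G : Type*} [TopologicalSpace G] [ChartedSpace F G]

/-! ### Differential forms on manifolds -/

/-- The coordinate expression of a `k`-form in the chart at `x₀`: its pullback along the inverse
of that chart, a `k`-form on the (open) target of the chart. -/
def formInChart {k : ℕ} (α : ∀ x : M, TangentSpace 𝓘(ℝ, E) x [⋀^Fin k]→L[ℝ] ℝ) (x₀ : M) :
    E → E [⋀^Fin k]→L[ℝ] ℝ := fun y =>
  (α ((extChartAt 𝓘(ℝ, E) x₀).symm y)).compContinuousLinearMap
    (mfderiv 𝓘(ℝ, E) 𝓘(ℝ, E) (extChartAt 𝓘(ℝ, E) x₀).symm y)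

/-- A `k`-form is smooth if all its coordinate expressions are. -/
def IsSmoothForm {k : ℕ} (α : ∀ x : M, TangentSpace 𝓘(ℝ, E) x [⋀^Fin k]→L[ℝ] ℝ) : Prop :=
  ∀ x₀ : M, ContDiffOn ℝ ∞ (formInChart α x₀) (extChartAt 𝓘(ℝ, E) x₀).target

/-- A (smooth) `k`-form `α` is closed, `dα = 0`, if the exterior derivatives of all its coordinate
expressions vanish. -/
def IsClosedForm {k : ℕ} (α : ∀ x : M, TangentSpace 𝓘(ℝ, E) x [⋀^Fin k]→L[ℝ] ℝ) : Prop :=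
  ∀ x₀ : M, ∀ y ∈ (extChartAt 𝓘(ℝ, E) x₀).target, extDeriv (formInChart α x₀) y = 0

/-- A field of covectors, regarded as a form of degree `1`. -/
def oneForm (η : ∀ x : M, TangentSpace 𝓘(ℝ, E) x →L[ℝ] ℝ) (x : M) :
    TangentSpace 𝓘(ℝ, E) x [⋀^Fin 1]→L[ℝ] ℝ :=
  ContinuousAlternatingMap.ofSubsingleton ℝ (TangentSpace 𝓘(ℝ, E) x) ℝ (0 : Fin 1) (η x)

/-- A `1`-form `β` is exact if `β = dh` for some smooth function `h`. -/
def IsExactOneForm (β : ∀ x : M, TangentSpace 𝓘(ℝ, E) x →L[ℝ] ℝ) : Prop :=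
  ∃ h : M → ℝ, ContMDiff 𝓘(ℝ, E) 𝓘(ℝ, ℝ) ∞ h ∧
    ∀ (x : M) (v : TangentSpace 𝓘(ℝ, E) x), mfderiv 𝓘(ℝ, E) 𝓘(ℝ, ℝ) h x v = β x v

/-! ### Cosymplectic structures -/

/-- The value of `η ∧ Ω ∧ ⋯ ∧ Ω` (`n` factors `Ω`) on `2n + 1` vectors, for a covector `η` and an
alternating bilinear form `Ω` on a vector space, with the convention
`(α ∧ β)(v) = 1 / (k! l!) ∑ σ, sign σ • α (v ∘ σ on the first k) β (v ∘ σ on the last l)`. -/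
def wedgeTop {V : Type*} [AddCommGroup V] [Module ℝ V] [TopologicalSpace V]
    (n : ℕ) (η : V →L[ℝ] ℝ) (Ω : V [⋀^Fin 2]→L[ℝ] ℝ) (v : Fin (2 * n + 1) → V) : ℝ :=
  (1 / 2 ^ n : ℝ) * ∑ σ : Equiv.Perm (Fin (2 * n + 1)), ((Equiv.Perm.sign σ : ℤ) : ℝ) *
    (η (v (σ 0)) * ∏ i : Fin n,
      Ω ![v (σ ⟨2 * i + 1, by omega⟩), v (σ ⟨2 * i + 2, by omega⟩)])

/-- `(Ω, η)` is a cosymplectic structure on the `(2n+1)`-dimensional manifold `M`: `Ω` is a closed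
`2`-form, `η` is a closed `1`-form, and `η ∧ Ω ^ n` is a volume form, that is, a form of top degree
without zeros. -/
structure IsCosymplectic (n : ℕ)
    (Ω : ∀ x : M, TangentSpace 𝓘(ℝ, E) x [⋀^Fin 2]→L[ℝ] ℝ)
    (η : ∀ x : M, TangentSpace 𝓘(ℝ, E) x →L[ℝ] ℝ) : Prop where
  dim_eq : Module.finrank ℝ E = 2 * n + 1
  smooth_omega : IsSmoothForm Ω
  smooth_eta : IsSmoothForm (oneForm η)
  closed_omega : IsClosedForm Ω
  closed_eta : IsClosedForm (oneForm η)
  volume : ∀ x : M, ∃ v : Fin (2 * n + 1) → TangentSpace 𝓘(ℝ, E) x, wedgeTop n (η x) (Ω x) v ≠ 0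

/-- The Reeb vector field of `(Ω, η)`: its value at `x` is the vector `R` characterized by
`i_R Ω = 0` and `i_R η = 1`. -/
def reebField (Ω : ∀ x : M, TangentSpace 𝓘(ℝ, E) x [⋀^Fin 2]→L[ℝ] ℝ)
    (η : ∀ x : M, TangentSpace 𝓘(ℝ, E) x →L[ℝ] ℝ) (x : M) : TangentSpace 𝓘(ℝ, E) x :=
  Classical.epsilon fun R : TangentSpace 𝓘(ℝ, E) x =>
    (∀ v : TangentSpace 𝓘(ℝ, E) x, Ω x ![R, v] = 0) ∧ η x R = 1

/-- The vector field `X` is complete with flow `Φ`: for every `x`, the curve `t ↦ Φ t x` is an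
integral curve of `X` that is defined on the whole real line and starts at `x`. -/
def IsCompleteWithFlow (X : ∀ x : M, TangentSpace 𝓘(ℝ, E) x) (Φ : ℝ → M → M) : Prop :=
  ∀ x : M, Φ 0 x = x ∧ IsMIntegralCurve (I := 𝓘(ℝ, E)) (fun t => Φ t x) X

/-! ### Actions of Lie groups -/

section Actions

variable [Group G]

/-- `φ` is a smooth (left) action of the Lie group `G` on `M`. -/
structure IsSmoothAction (φ : G → M → M) : Prop where
  one_act : ∀ x : M, φ 1 x = x
  mul_act : ∀ (g h : G) (x : M), φ (g * h) x = φ g (φ h x)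
  smooth : ContMDiff (𝓘(ℝ, F).prod 𝓘(ℝ, E)) 𝓘(ℝ, E) ∞ (fun p : G × M => φ p.1 p.2)

/-- The derivative at `1` of the orbit map `g ↦ φ g x`, as a linear map on the Lie algebra. Its value
at `ξ` is the vector `ξ_M(x)`, the value at `x` (which is `φ 1 x`) of the infinitesimal generator
`ξ_M` of the action. -/
def infinitesimalGenerator (φ : G → M → M) (x : M) :
    GroupLieAlgebra 𝓘(ℝ, F) G →L[ℝ] TangentSpace 𝓘(ℝ, E) x :=
  mfderiv 𝓘(ℝ, F) 𝓘(ℝ, E) (fun g : G => φ g x) 1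

/-- `φ` is a cosymplectic action: a smooth action with `φ_g^* Ω = Ω` and `φ_g^* η = η` for
all `g`. -/
structure IsCosymplecticAction (Ω : ∀ x : M, TangentSpace 𝓘(ℝ, E) x [⋀^Fin 2]→L[ℝ] ℝ)
    (η : ∀ x : M, TangentSpace 𝓘(ℝ, E) x →L[ℝ] ℝ) (φ : G → M → M) : Prop where
  isSmoothAction : IsSmoothAction (E := E) (F := F) φ
  pullback_omega : ∀ (g : G) (x : M),
    (Ω (φ g x)).compContinuousLinearMap (mfderiv 𝓘(ℝ, E) 𝓘(ℝ, E) (φ g) x) = Ω x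
  pullback_eta : ∀ (g : G) (x : M),
    (η (φ g x)).comp (mfderiv 𝓘(ℝ, E) 𝓘(ℝ, E) (φ g) x) = η x

/-- `J : M → 𝔤^*` is a momentum map of the action `φ`: it is smooth (as a map to the dual of the
finite-dimensional space `𝔤`, whose underlying normed space is `F`) and satisfies
`i_{ξ_M} Ω = d J_ξ` for all `ξ`, where `J_ξ(x) = J(x)(ξ)`. -/
structure IsMomentumMap (Ω : ∀ x : M, TangentSpace 𝓘(ℝ, E) x [⋀^Fin 2]→L[ℝ] ℝ) (φ : G → M → M)
    (J : M → GroupLieAlgebra 𝓘(ℝ, F) G →L[ℝ] ℝ) : Prop where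
  smooth : ContMDiff (M' := F →L[ℝ] ℝ) 𝓘(ℝ, E) 𝓘(ℝ, F →L[ℝ] ℝ) ∞ J
  contraction_eq : ∀ (ξ : GroupLieAlgebra 𝓘(ℝ, F) G) (x : M) (v : TangentSpace 𝓘(ℝ, E) x),
    Ω x ![infinitesimalGenerator φ x ξ, v]
      = mfderiv 𝓘(ℝ, E) 𝓘(ℝ, ℝ) (fun y : M => J y ξ) x v

/-- The adjoint representation: `Ad g` is the derivative at `1` of `h ↦ g h g⁻¹`. -/
def Ad (g : G) : GroupLieAlgebra 𝓘(ℝ, F) G →L[ℝ] GroupLieAlgebra 𝓘(ℝ, F) G :=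
  mfderiv 𝓘(ℝ, F) 𝓘(ℝ, F) (fun h : G => g * h * g⁻¹) 1

/-- The coadjoint representation on the dual of the Lie algebra:
`(coAd g μ)(ξ) = μ (Ad g⁻¹ ξ)`. -/
def coAd (g : G) (μ : GroupLieAlgebra 𝓘(ℝ, F) G →L[ℝ] ℝ) :
    GroupLieAlgebra 𝓘(ℝ, F) G →L[ℝ] ℝ :=
  μ.comp (Ad g⁻¹)

/-- `φ` is a Hamiltonian cosymplectic action with `G`-equivariant momentum map `J`. -/
structure IsEquivariantHamiltonianAction
    (Ω : ∀ x : M, TangentSpace 𝓘(ℝ, E) x [⋀^Fin 2]→L[ℝ] ℝ)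
    (η : ∀ x : M, TangentSpace 𝓘(ℝ, E) x →L[ℝ] ℝ) (φ : G → M → M)
    (J : M → GroupLieAlgebra 𝓘(ℝ, F) G →L[ℝ] ℝ) : Prop where
  isCosymplecticAction : IsCosymplecticAction (F := F) Ω η φ
  isMomentumMap : IsMomentumMap Ω φ J
  equivariant : ∀ (g : G) (x : M), J (φ g x) = coAd g (J x)

/-- The element `c_η` of the dual of the Lie algebra, `c_η(ξ) = η(ξ_M)`. For a cosymplectic action
on a connected manifold the function `η(ξ_M)` is constant; here it is evaluated at some point. -/
def etaCocycle [Nonempty M] (η : ∀ x : M, TangentSpace 𝓘(ℝ, E) x →L[ℝ] ℝ) (φ : G → M → M) :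
    GroupLieAlgebra 𝓘(ℝ, F) G →L[ℝ] ℝ :=
  (η (Classical.arbitrary M)).comp (infinitesimalGenerator φ (Classical.arbitrary M))

/-- The left-invariant `1`-form on `G` with value `c` at the identity: at `g` it is the composition
of `c` with the derivative at `g` of left multiplication by `g⁻¹`. -/
def leftInvariantForm (c : GroupLieAlgebra 𝓘(ℝ, F) G →L[ℝ] ℝ) (g : G) :
    TangentSpace 𝓘(ℝ, F) g →L[ℝ] ℝ :=
  c.comp (mfderiv 𝓘(ℝ, F) 𝓘(ℝ, F) (fun h : G => g⁻¹ * h) g :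
    TangentSpace 𝓘(ℝ, F) g →L[ℝ] TangentSpace 𝓘(ℝ, F) (1 : G))

/-- `f` is a smooth multiplicative function on `G` with `df = β`; multiplicative means that `f` is a
homomorphism into the additive group of the real numbers. -/
structure IsMultiplicativePrimitive (β : ∀ g : G, TangentSpace 𝓘(ℝ, F) g →L[ℝ] ℝ)
    (f : G → ℝ) : Prop where
  smooth : ContMDiff 𝓘(ℝ, F) 𝓘(ℝ, ℝ) ∞ f
  map_mul : ∀ g h : G, f (g * h) = f g + f h
  deriv_eq : ∀ (g : G) (v : TangentSpace 𝓘(ℝ, F) g), mfderiv 𝓘(ℝ, F) 𝓘(ℝ, ℝ) f g v = β g v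

/-- The modified action `g ↦ (x ↦ Φ_{f(g⁻¹)}(φ_g(x)))`. -/
def modifiedAction (Φ : ℝ → M → M) (f : G → ℝ) (φ : G → M → M) : G → M → M :=
  fun g x => Φ (f g⁻¹) (φ g x)

end Actions

end Cosymplectic

/-! Each `φ g` preserves `Ω` and `η`, hence the Reeb field `R`, which they determine; so it commutes
with the Reeb flow `Φ` (`IsCosymplecticAction.act_flow`). Since `f g⁻¹ = -f g` is again additive in
`g`, the maps `Φ (f g⁻¹) ∘ φ g` compose as an action. The flow preserves `Ω` and `η`, because the
Lie derivatives along `R` vanish: both forms are closed, `i_R Ω = 0` and `η(R) = 1`. The new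
generators are `ξ_M - c_η(ξ) R` (`modelDeriv_modifiedAction_orbit`). The correction lies in the
kernel of `Ω`, so the momentum equation is unchanged; it lowers `η(ξ_M) = c_η(ξ)` to zero.
Equivariance survives because `dJ_ξ(R) = Ω(ξ_M, R) = 0` makes `J` constant along the flow.

That `η(ξ_M)` is constant comes from a local primitive `H` of `η`: for `g` near `1`, `H ∘ φ g - H`
is locally constant, and differentiating in `g` at `1` gives the claim
(`eventually_oneForm_generator_eq`). In part (i), a primitive `h` of the left-invariant form is
normalized to vanish at `1`; left invariance makes `h(g k) - h(k)` independent of `k`.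

Most of the work is analytic: the flow of a smooth complete field must be jointly smooth
(`IsCompleteWithFlow.contMDiff`). Locally this is the implicit function theorem for the integral
equation in a Banach space of curves; the group law carries it to all times. Smoothness of `R`
itself comes from inverting the bundle map `v ↦ i_v Ω + η(v) η`. -/

open Set Filter Topology

/-! ### Superposition operators -/

section Superposition

variable {K : Type*} [TopologicalSpace K] [CompactSpace K]

/-- Pointwise application of a continuous family of continuous linear maps. -/
noncomputable def ContinuousMap.pointwiseApply (K : Type*) [TopologicalSpace K] [CompactSpace K]
    (E F : Type*) [NormedAddCommGroup E] [NormedSpace ℝ E] [NormedAddCommGroup F]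
    [NormedSpace ℝ F] : C(K, E →L[ℝ] F) →L[ℝ] C(K, E) →L[ℝ] C(K, F) :=
  LinearMap.mkContinuous₂
    (LinearMap.mk₂ ℝ (fun (A : C(K, E →L[ℝ] F)) (h : C(K, E)) =>
        (⟨fun t => A t (h t), by fun_prop⟩ : C(K, F)))
      (fun A B h => by ext t; simp) (fun c A h => by ext t; simp)
      (fun A h h' => by ext t; simp) (fun c A h => by ext t; simp)) 1
    (fun A h => by
      rw [ContinuousMap.norm_le _ (by positivity), one_mul]
      intro t
      exact (A t).le_of_opNorm_le_of_le (A.norm_coe_le_norm t) (h.norm_coe_le_norm t))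

/-- Composition with `g` is continuous for the sup norm on curves, which is what makes the bound
uniform in `t`. -/
theorem eventually_norm_comp_add_sub_lt {E W : Type*} [NormedAddCommGroup E] [NormedAddCommGroup W]
    (g : C(E, W)) (γ : C(K, E)) {c : ℝ} (hc : 0 < c) :
    ∀ᶠ h : C(K, E) in 𝓝 0, ∀ t, ‖g (γ t + h t) - g (γ t)‖ < c := by
  have hcont : Continuous fun h : C(K, E) => g.comp (γ + h) :=
    (ContinuousMap.continuous_postcomp g).comp (by fun_prop)
  have h0 : ContinuousAt (fun h : C(K, E) => ‖g.comp (γ + h) - g.comp γ‖) 0 := by fun_prop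
  exact (h0.eventually_lt_const (by simpa using hc)).mono fun h hh t =>
    (ContinuousMap.norm_coe_le_norm (g.comp (γ + h) - g.comp γ) t).trans_lt hh

/-- At each `t` the mean value inequality bounds the remainder by the oscillation of `g'` on a
segment times `‖h t‖`; the preceding lemma controls that oscillation for all `t` at once. -/
theorem hasFDerivAt_superposition {E F : Type*} [NormedAddCommGroup E] [NormedSpace ℝ E]
    [NormedAddCommGroup F] [NormedSpace ℝ F] (g : C(E, F)) (g' : C(E, E →L[ℝ] F))
    (hg : ∀ x, HasFDerivAt g (g' x) x) (γ : C(K, E)) :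
    HasFDerivAt (fun γ : C(K, E) => g.comp γ)
      (ContinuousMap.pointwiseApply K E F (g'.comp γ)) γ := by
  rw [hasFDerivAt_iff_isLittleO_nhds_zero, Asymptotics.isLittleO_iff]
  intro c hc
  obtain ⟨r, hr, hball⟩ := Metric.eventually_nhds_iff_ball.1
    (eventually_norm_comp_add_sub_lt g' γ hc)
  filter_upwards [Metric.ball_mem_nhds _ hr] with h hh
  rw [ContinuousMap.norm_le _ (by positivity)]
  intro t
  have hseg : ∀ y ∈ segment ℝ (γ t) (γ t + h t), ‖g' y - g' (γ t)‖ ≤ c := by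
    intro y hy
    rw [segment_eq_image'] at hy
    obtain ⟨θ, hθ, rfl⟩ := hy
    -- A point of the segment is `γ t + θ • h t`, a value of the curve `γ + θ • h`, so the uniform
    -- estimate is applied to `θ • h`.
    have hmem : θ • h ∈ Metric.ball (0 : C(K, E)) r := by
      rw [mem_ball_zero_iff] at hh ⊢
      rw [norm_smul, Real.norm_of_nonneg hθ.1]
      exact lt_of_le_of_lt (mul_le_of_le_one_left (norm_nonneg _) hθ.2) hh
    simpa using (hball _ hmem t).le
  have := (convex_segment (γ t) (γ t + h t)).norm_image_sub_le_of_norm_hasFDerivWithin_le'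
    (f := g) (f' := fun y => g' y) (φ := g' (γ t))
    (fun y _ => (hg y).hasFDerivWithinAt) hseg (left_mem_segment ℝ _ _) (right_mem_segment ℝ _ _)
  simp only [add_sub_cancel_left] at this
  refine this.trans ?_
  gcongr
  exact h.norm_coe_le_norm t

/-- Induction on `k`: the derivative is the superposition operator of `fderiv ℝ g` followed by a
continuous linear map. The induction replaces `F` by `E →L[ℝ] F`, so `F` is quantified inside and
shares the universe of `E`. -/
theorem contDiff_superposition.{u} {E : Type u} [NormedAddCommGroup E] [NormedSpace ℝ E] (k : ℕ) :
    ∀ {F : Type u} [NormedAddCommGroup F] [NormedSpace ℝ F] (g : C(E, F)), ContDiff ℝ k g →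
      ContDiff ℝ k (fun γ : C(K, E) => g.comp γ) := by
  induction k with
  | zero =>
    intro F _ _ g _
    exact contDiff_zero.2 (ContinuousMap.continuous_postcomp g)
  | succ k ih =>
    intro F _ _ g hg
    have hg' : ContDiff ℝ k (fderiv ℝ g) := hg.fderiv_right (by norm_cast)
    have hd : ∀ x, HasFDerivAt g (fderiv ℝ g x) x := fun x =>
      (hg.differentiable (by simp)).differentiableAt.hasFDerivAt
    refine (contDiff_succ_iff_hasFDerivAt (n := k)).2 ⟨_, ?_, fun γ =>
      hasFDerivAt_superposition g ⟨fderiv ℝ g, hg'.continuous⟩ hd γ⟩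
    exact (ContinuousMap.pointwiseApply K E F).contDiff.comp (ih ⟨fderiv ℝ g, hg'.continuous⟩ hg')

end Superposition

/-! ### Smooth dependence of local flows on the initial value -/

section LocalFlow

variable {E : Type*} [NormedAddCommGroup E] [NormedSpace ℝ E]

/-- The operator `γ ↦ (t ↦ ∫ u in 0..t, γ u)` on continuous curves on `[-1, 1]`. -/
noncomputable def integralOperator (E : Type*) [NormedAddCommGroup E] [NormedSpace ℝ E] :
    C(Icc (-1 : ℝ) 1, E) →L[ℝ] C(Icc (-1 : ℝ) 1, E) :=
  LinearMap.mkContinuous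
    { toFun := fun γ => ⟨fun t => ∫ u in (0 : ℝ)..t, IccExtend (by norm_num) γ u,
        (intervalIntegral.continuous_primitive (fun a b =>
          (γ.continuous.Icc_extend' (h := by norm_num)).intervalIntegrable a b) 0).comp
          continuous_subtype_val⟩
      map_add' := fun γ γ' => by
        ext t
        exact intervalIntegral.integral_add
          ((γ.continuous.Icc_extend' (h := by norm_num)).intervalIntegrable _ _)
          ((γ'.continuous.Icc_extend' (h := by norm_num)).intervalIntegrable _ _)
      map_smul' := fun c γ => by
        ext t
        exact intervalIntegral.integral_smul c _ } 1
    (fun γ => by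
      rw [ContinuousMap.norm_le _ (by positivity), one_mul]
      intro t
      have := intervalIntegral.norm_integral_le_of_norm_le_const (a := (0 : ℝ)) (b := t)
        (f := IccExtend (by norm_num) γ) (C := ‖γ‖) (fun u _ => γ.norm_coe_le_norm _)
      refine this.trans (mul_le_of_le_one_right (norm_nonneg _) ?_)
      rw [sub_zero, abs_le]
      exact t.2)

theorem integralOperator_apply (γ : C(Icc (-1 : ℝ) 1, E)) (t : Icc (-1 : ℝ) 1) :
    integralOperator E γ t =
      ∫ u in (0 : ℝ)..t, IccExtend (by norm_num : (-1 : ℝ) ≤ 1) γ u := rfl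

/-- The embedding of `E` as the constant curves on `[-1, 1]`. -/
noncomputable def constantCurve (E : Type*) [NormedAddCommGroup E] [NormedSpace ℝ E] :
    E →L[ℝ] C(Icc (-1 : ℝ) 1, E) where
  toFun := ContinuousMap.const _
  map_add' _ _ := rfl
  map_smul' _ _ := rfl
  cont := ContinuousMap.continuous_const'

/-- The initial value problem `γ' = s • X γ`, `γ 0 = x` in integral form. -/
noncomputable def integralEquation (X : C(E, E)) (q : (E × ℝ) × C(Icc (-1 : ℝ) 1, E)) :
    C(Icc (-1 : ℝ) 1, E) :=
  q.2 - constantCurve E q.1.1 - q.1.2 • integralOperator E (X.comp q.2)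

theorem contDiff_integralEquation (k : ℕ) (X : C(E, E)) (hX : ContDiff ℝ k X) :
    ContDiff ℝ k (integralEquation X) := by
  have h := (contDiff_superposition (K := Icc (-1 : ℝ) 1) k X hX).comp
    (contDiff_snd (E := E × ℝ) (F := C(Icc (-1 : ℝ) 1, E)))
  have h' := (integralOperator E).contDiff.comp h
  refine (contDiff_snd.sub ?_).sub ((contDiff_snd.comp contDiff_fst).smul h')
  exact (constantCurve E).contDiff.comp (contDiff_fst.comp contDiff_fst)

/-- The implicit function theorem is applied to `integralEquation` at `s = 0`, where the constant
curve is a solution. The factor `s` in `γ' = s • X γ` rescales time, so all curves live on one fixed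
interval. The value is taken at `1 / 2`, inside the open interval where the differential equation
holds; thus `Ψ (x, s)` is the flow at time `s / 2`. -/
theorem exists_contDiffAt_local_flow [CompleteSpace E] (k : ℕ) (hk : k ≠ 0) (X : E → E)
    (hX : ContDiff ℝ k X) (x₀ : E) {U : Set E} (hU : U ∈ 𝓝 x₀) :
    ∃ Ψ : E × ℝ → E, ContDiffAt ℝ k Ψ (x₀, 0) ∧ ∀ᶠ p in 𝓝 (x₀, (0 : ℝ)), ∃ u : ℝ → E,
      u 0 = p.1 ∧ u (1 / 2) = Ψ p ∧
        ∀ t ∈ Ioo (-1 : ℝ) 1, HasDerivAt u (p.2 • X (u t)) t ∧ u t ∈ U := by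
  let X' : C(E, E) := ⟨X, hX.continuous⟩
  let c₀ : C(Icc (-1 : ℝ) 1, E) := constantCurve E x₀
  have hH := contDiff_integralEquation k X' hX
  have hk' : ((k : ℕ) : WithTop ℕ∞) ≠ 0 := by exact_mod_cast hk
  have hHu : ContDiffAt ℝ k (integralEquation X') ((x₀, 0), c₀) := hH.contDiffAt
  have hzero : integralEquation X' ((x₀, 0), c₀) = 0 := by simp [integralEquation, c₀]
  -- At `s = 0` the integral term drops out and the equation is `γ - x₀`, so its partial derivative
  -- in `γ` is the identity.
  have hinr : fderiv ℝ (integralEquation X') ((x₀, 0), c₀) ∘L .inr ℝ (E × ℝ) _ =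
      ContinuousLinearMap.id ℝ _ := by
    have h1 := (hHu.differentiableAt hk').hasFDerivAt.comp c₀
      (hasFDerivAt_prodMk_right (x₀, (0 : ℝ)) c₀)
    refine h1.unique ?_
    have : (integralEquation X' ∘ fun y => ((x₀, (0 : ℝ)), y)) =
        fun y => y - constantCurve E x₀ := by
      ext; simp [integralEquation]
    rw [this]
    exact (hasFDerivAt_id _).sub_const _
  have hinv : (fderiv ℝ (integralEquation X') ((x₀, 0), c₀) ∘L .inr ℝ (E × ℝ) _).IsInvertible := by
    rw [hinr]; exact ⟨.refl ℝ _, rfl⟩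
  let ψ := hHu.implicitFunction hk' hinv
  have hψ : ContDiffAt ℝ k ψ (x₀, 0) := hHu.contDiffAt_implicitFunction hk' hinv
  have hψ0 : ψ (x₀, 0) = c₀ := hHu.implicitFunction_apply_self hk' hinv
  have hev : ∀ᶠ p in 𝓝 (x₀, (0 : ℝ)), integralEquation X' (p, ψ p) = 0 := by
    have := hHu.eventually_apply_implicitFunction hk' hinv
    rwa [hzero] at this
  obtain ⟨r, hr, hrU⟩ := Metric.mem_nhds_iff.1 hU
  have hclose : ∀ᶠ p in 𝓝 (x₀, (0 : ℝ)), ψ p ∈ Metric.ball c₀ r :=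
    hψ.continuousAt.eventually (by rw [hψ0]; exact Metric.ball_mem_nhds _ hr)
  have hmem : (1 / 2 : ℝ) ∈ Icc (-1 : ℝ) 1 := by constructor <;> norm_num
  refine ⟨fun p => ψ p ⟨1 / 2, hmem⟩,
    (ContinuousMap.evalCLM (M := E) ℝ
      (⟨1 / 2, hmem⟩ : Icc (-1 : ℝ) 1)).contDiff.contDiffAt.comp (x₀, (0 : ℝ)) hψ, ?_⟩
  filter_upwards [hev, hclose] with p hp hpr
  have hψp : ∀ t : Icc (-1 : ℝ) 1, ψ p t =
      p.1 + p.2 • ∫ u in (0 : ℝ)..t, IccExtend (by norm_num : (-1 : ℝ) ≤ 1) (X'.comp (ψ p)) u := by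
    intro t
    have := congrArg (fun γ : C(Icc (-1 : ℝ) 1, E) => γ t) hp
    simp only [integralEquation, ContinuousMap.sub_apply, ContinuousMap.smul_apply,
      integralOperator_apply, ContinuousMap.zero_apply] at this
    rw [sub_sub, sub_eq_zero] at this
    exact this
  have hcont : Continuous (IccExtend (by norm_num : (-1 : ℝ) ≤ 1) (X'.comp (ψ p))) :=
    (X'.comp (ψ p)).continuous.Icc_extend'
  -- This primitive is defined on all of `ℝ` and agrees with `ψ p` on `[-1, 1]`, which permits
  -- ordinary derivatives.
  refine ⟨fun t => p.1 + p.2 • ∫ u in (0 : ℝ)..t,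
    IccExtend (by norm_num : (-1 : ℝ) ≤ 1) (X'.comp (ψ p)) u, by simp, (hψp ⟨1 / 2, hmem⟩).symm, ?_⟩
  intro t ht
  have hval := hψp ⟨t, Ioo_subset_Icc_self ht⟩
  constructor
  · have h1 := (intervalIntegral.integral_hasDerivAt_right (hcont.intervalIntegrable 0 t)
      hcont.stronglyMeasurable.stronglyMeasurableAtFilter hcont.continuousAt)
    have h2 := (h1.const_smul p.2).const_add p.1
    rw [IccExtend_of_mem _ _ (Ioo_subset_Icc_self ht)] at h2
    simp only [← hval]
    exact h2
  · apply hrU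
    simp only [← hval]
    rw [Metric.mem_ball, dist_eq_norm] at hpr ⊢
    exact lt_of_le_of_lt (ContinuousMap.norm_coe_le_norm (ψ p - c₀) ⟨t, Ioo_subset_Icc_self ht⟩) hpr

end LocalFlow

/-! ### Tangent vectors and vector fields in charts -/

section Charts

variable {E : Type*} [NormedAddCommGroup E] [NormedSpace ℝ E]
  {M : Type*} [TopologicalSpace M] [ChartedSpace E M]

/-- The coordinate expression of a vector field in the chart at `x₀`. -/
noncomputable def fieldInChart (X : ∀ x : M, TangentSpace 𝓘(ℝ, E) x) (x₀ : M) : E → E := fun y =>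
  mfderiv 𝓘(ℝ, E) 𝓘(ℝ, E) (extChartAt 𝓘(ℝ, E) x₀) ((extChartAt 𝓘(ℝ, E) x₀).symm y)
    (X ((extChartAt 𝓘(ℝ, E) x₀).symm y))

/-- A vector field is smooth if all its coordinate expressions are. -/
def IsSmoothField (X : ∀ x : M, TangentSpace 𝓘(ℝ, E) x) : Prop :=
  ∀ x₀ : M, ContDiffOn ℝ ∞ (fieldInChart X x₀) (extChartAt 𝓘(ℝ, E) x₀).target

theorem fieldInChart_extChartAt (X : ∀ x : M, TangentSpace 𝓘(ℝ, E) x) {x₀ x : M}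
    (hx : x ∈ (extChartAt 𝓘(ℝ, E) x₀).source) :
    fieldInChart X x₀ (extChartAt 𝓘(ℝ, E) x₀ x) =
      mfderiv 𝓘(ℝ, E) 𝓘(ℝ, E) (extChartAt 𝓘(ℝ, E) x₀) x (X x) := by
  -- The tangent space depends on the point, so the point is generalized before the equality `e.symm
  -- (e x) = x` is substituted.
  have key : ∀ z, z = x → (mfderiv 𝓘(ℝ, E) 𝓘(ℝ, E) (extChartAt 𝓘(ℝ, E) x₀) z (X z) : E) =
      mfderiv 𝓘(ℝ, E) 𝓘(ℝ, E) (extChartAt 𝓘(ℝ, E) x₀) x (X x) := by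
    rintro _ rfl; rfl
  exact key _ ((extChartAt 𝓘(ℝ, E) x₀).left_inv hx)

theorem IsSmoothField.const_smul {X : ∀ x : M, TangentSpace 𝓘(ℝ, E) x} (hX : IsSmoothField X)
    (c : ℝ) : IsSmoothField (c • X) := by
  intro x₀
  refine ((hX x₀).const_smul c).congr fun y _ => ?_
  exact map_smul _ _ _

variable [IsManifold 𝓘(ℝ, E) ∞ M]

theorem contMDiffAt_extChartAt_of_mem_source {x₀ x : M} (hx : x ∈ (extChartAt 𝓘(ℝ, E) x₀).source) :
    ContMDiffAt 𝓘(ℝ, E) 𝓘(ℝ, E) ∞ (extChartAt 𝓘(ℝ, E) x₀) x :=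
  contMDiffAt_extChartAt' (by rwa [extChartAt_source] at hx)

theorem contMDiffAt_extChartAt_symm {x₀ : M} {y : E} (hy : y ∈ (extChartAt 𝓘(ℝ, E) x₀).target) :
    ContMDiffAt 𝓘(ℝ, E) 𝓘(ℝ, E) ∞ (extChartAt 𝓘(ℝ, E) x₀).symm y :=
  (contMDiffOn_extChartAt_symm x₀).contMDiffAt ((isOpen_extChartAt_target x₀).mem_nhds hy)

theorem mdifferentiableAt_extChartAt_of_mem_source {x₀ x : M}
    (hx : x ∈ (extChartAt 𝓘(ℝ, E) x₀).source) :
    MDifferentiableAt 𝓘(ℝ, E) 𝓘(ℝ, E) (extChartAt 𝓘(ℝ, E) x₀) x :=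
  (contMDiffAt_extChartAt_of_mem_source hx).mdifferentiableAt (by simp)

theorem mdifferentiableAt_extChartAt_symm {x₀ : M} {y : E}
    (hy : y ∈ (extChartAt 𝓘(ℝ, E) x₀).target) :
    MDifferentiableAt 𝓘(ℝ, E) 𝓘(ℝ, E) (extChartAt 𝓘(ℝ, E) x₀).symm y :=
  (contMDiffAt_extChartAt_symm hy).mdifferentiableAt (by simp)

theorem mfderiv_extChartAt_mfderiv_symm {x₀ : M} {y : E}
    (hy : y ∈ (extChartAt 𝓘(ℝ, E) x₀).target) (v : TangentSpace 𝓘(ℝ, E) y) :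
    mfderiv 𝓘(ℝ, E) 𝓘(ℝ, E) (extChartAt 𝓘(ℝ, E) x₀) ((extChartAt 𝓘(ℝ, E) x₀).symm y)
      (mfderiv 𝓘(ℝ, E) 𝓘(ℝ, E) (extChartAt 𝓘(ℝ, E) x₀).symm y v) = v := by
  have := mfderiv_extChartAt_comp_mfderivWithin_extChartAt_symm (I := 𝓘(ℝ, E)) hy
  rw [ModelWithCorners.range_eq_univ, mfderivWithin_univ] at this
  exact DFunLike.congr_fun this v

theorem mfderiv_symm_mfderiv_extChartAt {x₀ : M} {y : E}
    (hy : y ∈ (extChartAt 𝓘(ℝ, E) x₀).target)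
    (v : TangentSpace 𝓘(ℝ, E) ((extChartAt 𝓘(ℝ, E) x₀).symm y)) :
    mfderiv 𝓘(ℝ, E) 𝓘(ℝ, E) (extChartAt 𝓘(ℝ, E) x₀).symm y
      (mfderiv 𝓘(ℝ, E) 𝓘(ℝ, E) (extChartAt 𝓘(ℝ, E) x₀) ((extChartAt 𝓘(ℝ, E) x₀).symm y) v) = v := by
  have := mfderivWithin_extChartAt_symm_comp_mfderiv_extChartAt (I := 𝓘(ℝ, E)) hy
  rw [ModelWithCorners.range_eq_univ, mfderivWithin_univ] at this
  exact DFunLike.congr_fun this v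

/-- The trivialization of the tangent bundle at `x₀` is the derivative of the chart at `x₀`. Class
`C¹` is what uniqueness of integral curves requires. -/
theorem IsSmoothField.contMDiff {X : ∀ x : M, TangentSpace 𝓘(ℝ, E) x} (hX : IsSmoothField X) :
    ContMDiff 𝓘(ℝ, E) 𝓘(ℝ, E).tangent 1 (fun x => (⟨x, X x⟩ : TangentBundle 𝓘(ℝ, E) M)) := by
  intro x₀
  rw [Bundle.contMDiffAt_section]
  have h1 : ContMDiffAt 𝓘(ℝ, E) 𝓘(ℝ, E) 1
      (fieldInChart X x₀ ∘ extChartAt 𝓘(ℝ, E) x₀) x₀ := by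
    refine ContMDiffAt.comp x₀ (contMDiffAt_iff_contDiffAt.2 ?_) contMDiffAt_extChartAt
    exact ((hX x₀).contDiffAt (extChartAt_target_mem_nhds x₀)).of_le (by norm_cast)
  refine h1.congr_of_eventuallyEq ?_
  filter_upwards [extChartAt_source_mem_nhds (I := 𝓘(ℝ, E)) x₀] with x hx
  have h2 := TangentBundle.continuousLinearMapAt_trivializationAt (I := 𝓘(ℝ, E)) (x₀ := x₀) (x := x)
    (by rwa [extChartAt_source] at hx)
  have h3 := DFunLike.congr_fun h2 (X x)
  have hb : x ∈ (trivializationAt E (TangentSpace 𝓘(ℝ, E)) x₀).baseSet := by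
    rwa [TangentBundle.trivializationAt_baseSet, ← extChartAt_source 𝓘(ℝ, E)]
  rw [Bundle.Trivialization.continuousLinearMapAt_apply,
    Bundle.Trivialization.linearMapAt_def_of_mem _ hb] at h3
  exact h3.trans (fieldInChart_extChartAt X hx).symm

theorem hasMFDerivAt_extChartAt_symm_comp {X : ∀ x : M, TangentSpace 𝓘(ℝ, E) x} {x₀ : M}
    {u : ℝ → E} {t : ℝ} (hu : HasDerivAt u (fieldInChart X x₀ (u t)) t)
    (ht : u t ∈ (extChartAt 𝓘(ℝ, E) x₀).target) :
    HasMFDerivAt 𝓘(ℝ, ℝ) 𝓘(ℝ, E) (fun t => (extChartAt 𝓘(ℝ, E) x₀).symm (u t)) t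
      ((1 : ℝ →L[ℝ] ℝ).smulRight (X ((extChartAt 𝓘(ℝ, E) x₀).symm (u t)))) := by
  have h1 := (mdifferentiableAt_extChartAt_symm ht).hasMFDerivAt
  refine (h1.comp t hu.hasFDerivAt.hasMFDerivAt).congr_mfderiv ?_
  refine ContinuousLinearMap.ext fun (r : ℝ) => ?_
  have h2 := mfderiv_symm_mfderiv_extChartAt ht (X ((extChartAt 𝓘(ℝ, E) x₀).symm (u t)))
  exact (map_smul (mfderiv 𝓘(ℝ, E) 𝓘(ℝ, E) (extChartAt 𝓘(ℝ, E) x₀).symm (u t)) r _).trans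
    (congrArg (fun w => r • w) h2)

theorem hasDerivAt_extChartAt_comp {X : ∀ x : M, TangentSpace 𝓘(ℝ, E) x} {x₀ : M}
    {γ : ℝ → M} {t : ℝ} (hγ : HasMFDerivAt 𝓘(ℝ, ℝ) 𝓘(ℝ, E) γ t
      ((1 : ℝ →L[ℝ] ℝ).smulRight (X (γ t))))
    (ht : γ t ∈ (extChartAt 𝓘(ℝ, E) x₀).source) :
    HasDerivAt (fun t => extChartAt 𝓘(ℝ, E) x₀ (γ t))
      (fieldInChart X x₀ (extChartAt 𝓘(ℝ, E) x₀ (γ t))) t := by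
  have h1 := (mdifferentiableAt_extChartAt_of_mem_source ht).hasMFDerivAt.comp t hγ
  have h2 := hasMFDerivAt_iff_hasFDerivAt.1 h1
  refine h2.congr_fderiv (ContinuousLinearMap.ext fun (r : ℝ) => ?_)
  exact (map_smul (mfderiv 𝓘(ℝ, E) 𝓘(ℝ, E) (extChartAt 𝓘(ℝ, E) x₀) (γ t)) r (X (γ t))).trans
    (congrArg (fun w : E => r • w) (fieldInChart_extChartAt X ht).symm)

end Charts

/-! ### Smoothness of the flow of a complete vector field -/

section Flow

/-- Multiplication by a bump function: the integral equation needs a field defined on the whole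
model space. -/
theorem exists_contDiff_eqOn_ball {E : Type*} [NormedAddCommGroup E] [NormedSpace ℝ E]
    [FiniteDimensional ℝ E] {W : Type*} [NormedAddCommGroup W] [NormedSpace ℝ W] {U : Set E}
    {f : E → W} (hf : ContDiffOn ℝ ∞ f U) (hU : IsOpen U) {x₀ : E} (hx₀ : x₀ ∈ U) :
    ∃ (g : E → W) (r : ℝ), ContDiff ℝ ∞ g ∧ 0 < r ∧ Metric.ball x₀ r ⊆ U ∧
      EqOn g f (Metric.ball x₀ r) := by
  obtain ⟨ε, hε, hεU⟩ := Metric.isOpen_iff.1 hU x₀ hx₀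
  let χ : ContDiffBump x₀ := ⟨ε / 3, ε / 2, by positivity, by linarith⟩
  have hsub : Metric.ball x₀ (ε / 3) ⊆ U := (Metric.ball_subset_ball (by linarith)).trans hεU
  refine ⟨fun x => χ x • f x, ε / 3, ?_, by positivity, hsub, ?_⟩
  · rw [contDiff_iff_contDiffAt]
    intro x
    by_cases hx : x ∈ U
    · exact χ.contDiff.contDiffAt.smul (hf.contDiffAt (hU.mem_nhds hx))
    · have : x ∉ tsupport χ := by
        rw [χ.tsupport_eq]
        intro hx'
        exact hx (hεU (Metric.closedBall_subset_ball (by change ε / 2 < ε; linarith) hx'))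
      refine (contDiffAt_const (c := (0 : W))).congr_of_eventuallyEq ?_
      filter_upwards [(isClosed_tsupport χ).isOpen_compl.mem_nhds this] with y hy
      rw [image_eq_zero_of_notMem_tsupport hy, zero_smul]
  · intro x hx
    have : χ x = 1 := χ.one_of_mem_closedBall (Metric.ball_subset_closedBall hx)
    simp only [this, one_smul]

variable {E : Type*} [NormedAddCommGroup E] [NormedSpace ℝ E]
  {M : Type*} [TopologicalSpace M] [ChartedSpace E M] [IsManifold 𝓘(ℝ, E) ∞ M]
  [T2Space M] {X : ∀ x : M, TangentSpace 𝓘(ℝ, E) x} {Φ : ℝ → M → M}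

theorem IsCompleteWithFlow.eq_of_isMIntegralCurve (hΦ : IsCompleteWithFlow X Φ)
    (hX : IsSmoothField X) {γ : ℝ → M} (hγ : IsMIntegralCurve (I := 𝓘(ℝ, E)) γ X) (t : ℝ) :
    γ t = Φ t (γ 0) :=
  congrFun (isMIntegralCurve_Ioo_eq_of_contMDiff_boundaryless (t₀ := 0) hX.contMDiff hγ
    (hΦ (γ 0)).2 (hΦ (γ 0)).1.symm) t

/-- Both sides are integral curves in `s` with the same value at `s = 0`. -/
theorem IsCompleteWithFlow.add_apply (hΦ : IsCompleteWithFlow X Φ) (hX : IsSmoothField X)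
    (s t : ℝ) (x : M) : Φ (s + t) x = Φ s (Φ t x) := by
  have h := hΦ.eq_of_isMIntegralCurve hX ((hΦ x).2.comp_add t) s
  simpa using h

/-- The local solutions for the cut-off field stay in the ball where it equals `X`, so they lift to
integral curves of `(2 * s) • X`. By uniqueness they are `t ↦ Φ (2 * s * t) x`, which at `t = 1 / 2`
is `Φ s x`. -/
theorem IsCompleteWithFlow.contMDiffAt_zero [FiniteDimensional ℝ E] (hΦ : IsCompleteWithFlow X Φ)
    (hX : IsSmoothField X) (k : ℕ) (hk : k ≠ 0) (x₀ : M) :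
    ContMDiffAt (𝓘(ℝ, ℝ).prod 𝓘(ℝ, E)) 𝓘(ℝ, E) k (fun p : ℝ × M => Φ p.1 p.2) (0, x₀) := by
  set e := extChartAt 𝓘(ℝ, E) x₀ with he
  obtain ⟨Y, r, hY, hr, hsub, hYX⟩ := exists_contDiff_eqOn_ball (hX x₀)
    (isOpen_extChartAt_target x₀) (mem_extChartAt_target x₀)
  obtain ⟨Ψ, hΨ, hev⟩ := exists_contDiffAt_local_flow k hk Y (hY.of_le (by exact_mod_cast le_top))
    (e x₀) (Metric.ball_mem_nhds _ hr)
  have h0mem : (0 : ℝ) ∈ Ioo (-1 : ℝ) 1 := by norm_num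
  have hmem : (1 / 2 : ℝ) ∈ Ioo (-1 : ℝ) 1 := by norm_num
  have hΨ0 : Ψ (e x₀, 0) ∈ e.target := by
    obtain ⟨u, -, hu, hu'⟩ := hev.self_of_nhds
    exact hu ▸ hsub (hu' _ hmem).2
  -- the map `(s, x) ↦ (e x, 2 s)`
  have hinner : ContMDiffAt (𝓘(ℝ, ℝ).prod 𝓘(ℝ, E)) 𝓘(ℝ, E × ℝ) k
      (fun p : ℝ × M => (e p.2, 2 * p.1)) (0, x₀) := by
    refine ContMDiffAt.prodMk_space ?_ ?_
    · refine ContMDiffAt.comp (0, x₀) (g := e) (f := Prod.snd) ?_ contMDiffAt_snd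
      exact (contMDiffAt_extChartAt_of_mem_source (mem_extChartAt_source x₀)).of_le
        (by exact_mod_cast le_top)
    · exact ((contDiff_const.mul contDiff_id).contMDiff.contMDiffAt (x := (0 : ℝ))).comp (0, x₀)
        contMDiffAt_fst
  have hcomp : ContMDiffAt (𝓘(ℝ, ℝ).prod 𝓘(ℝ, E)) 𝓘(ℝ, E) k
      (fun p : ℝ × M => e.symm (Ψ (e p.2, 2 * p.1))) (0, x₀) := by
    have h1 : ContMDiffAt (𝓘(ℝ, ℝ).prod 𝓘(ℝ, E)) 𝓘(ℝ, E) k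
        (fun p : ℝ × M => Ψ (e p.2, 2 * p.1)) (0, x₀) :=
      ContMDiffAt.comp (0, x₀) (g := Ψ) (f := fun p : ℝ × M => (e p.2, 2 * p.1))
        (by simpa using hΨ.contMDiffAt) hinner
    refine ContMDiffAt.comp (0, x₀) (g := e.symm) ?_ h1
    simp only [mul_zero]
    exact (contMDiffAt_extChartAt_symm hΨ0).of_le (by exact_mod_cast le_top)
  refine hcomp.congr_of_eventuallyEq ?_
  have htend : Tendsto (fun p : ℝ × M => (e p.2, 2 * p.1)) (𝓝 (0, x₀)) (𝓝 (e x₀, 0)) := by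
    have := hinner.continuousAt
    simpa [ContinuousAt] using this
  have hsrc : ∀ᶠ p : ℝ × M in 𝓝 (0, x₀), p.2 ∈ e.source :=
    continuousAt_snd.eventually (extChartAt_source_mem_nhds x₀)
  filter_upwards [htend.eventually hev, hsrc] with p hp hps
  obtain ⟨u, hu0, hu1, hu⟩ := hp
  have hcurve : IsMIntegralCurveOn (I := 𝓘(ℝ, E)) (fun t => e.symm (u t)) ((2 * p.1) • X)
      (Ioo (-1) 1) := by
    intro t ht
    refine (hasMFDerivAt_extChartAt_symm_comp ?_ (hsub (hu t ht).2)).hasMFDerivWithinAt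
    have h1 := (hu t ht).1
    rw [hYX (hu t ht).2] at h1
    convert h1 using 1
    exact map_smul (mfderiv 𝓘(ℝ, E) 𝓘(ℝ, E) e (e.symm (u t))) (2 * p.1) _
  have hflow := ((hΦ p.2).2.comp_mul (2 * p.1)).isMIntegralCurveOn (Ioo (-1) 1)
  have heq := isMIntegralCurveOn_Ioo_eqOn_of_contMDiff_boundaryless h0mem
    (hX.const_smul (2 * p.1)).contMDiff hcurve hflow
    (by simp [hu0, (hΦ p.2).1, e.left_inv hps]) hmem
  simp only [hu1, Function.comp_apply] at heq
  rw [heq]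
  congr 1
  ring

/-- For fixed `x₀`, the times at which `Φ` is `C^k` at `(t, x₀)` form a nonempty clopen set. For
closedness, take such an `s` close to `t` and factor `Φ r = Φ (r - s) ∘ Φ s`, where the first factor
is covered by regularity near time zero. -/
theorem IsCompleteWithFlow.contMDiff [FiniteDimensional ℝ E] (hΦ : IsCompleteWithFlow X Φ)
    (hX : IsSmoothField X) :
    ContMDiff (𝓘(ℝ, ℝ).prod 𝓘(ℝ, E)) 𝓘(ℝ, E) ∞ (fun p : ℝ × M => Φ p.1 p.2) := by
  suffices h : ∀ k : ℕ, k ≠ 0 → ContMDiff (𝓘(ℝ, ℝ).prod 𝓘(ℝ, E)) 𝓘(ℝ, E) k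
      (fun p : ℝ × M => Φ p.1 p.2) from
    contMDiff_infty.2 fun k => (h (k + 1) k.succ_ne_zero).of_le (by exact_mod_cast k.le_succ)
  rintro k hk ⟨t₀, x₀⟩
  -- Working with finite `k` matters: being `C^k` at a point is then an open condition.
  have hk' : ((k : ℕ) : WithTop ℕ∞) ≠ ∞ := by exact_mod_cast ENat.natCast_ne_top k
  let S : Set ℝ := {t | ContMDiffAt (𝓘(ℝ, ℝ).prod 𝓘(ℝ, E)) 𝓘(ℝ, E) k
    (fun p : ℝ × M => Φ p.1 p.2) (t, x₀)}
  have : IsManifold 𝓘(ℝ, E) k M := .of_le (n := ∞) (by exact_mod_cast le_top)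
  have hopen : IsOpen S := by
    rw [isOpen_iff_mem_nhds]
    intro t ht
    have h1 := (contMDiffAt_iff_contMDiffAt_nhds hk').1 ht
    have h2 : Tendsto (fun s : ℝ => (s, x₀)) (𝓝 t) (𝓝 (t, x₀)) := by
      exact (Continuous.prodMk_left x₀).tendsto t
    exact h2.eventually h1
  have hclosed : IsClosed S := by
    rw [← closure_subset_iff_isClosed]
    intro t ht
    have h1 := (contMDiffAt_iff_contMDiffAt_nhds hk').1 (hΦ.contMDiffAt_zero hX k hk (Φ t x₀))
    have hcont : Tendsto (fun s : ℝ => (t - s, Φ s x₀)) (𝓝 t) (𝓝 (0, Φ t x₀)) := by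
      have h2 : Continuous fun s : ℝ => (t - s, Φ s x₀) :=
        (continuous_const.sub continuous_id).prodMk (hΦ x₀).2.continuous
      simpa using h2.tendsto t
    obtain ⟨s, hs, hsS⟩ := (mem_closure_iff_nhds.1 ht) _ (hcont.eventually h1)
    have h3 : ContMDiffAt (𝓘(ℝ, ℝ).prod 𝓘(ℝ, E)) (𝓘(ℝ, ℝ).prod 𝓘(ℝ, E)) k
        (fun p : ℝ × M => (p.1 - s, Φ s p.2)) (t, x₀) := by
      refine ContMDiffAt.prodMk ?_ ?_
      · exact ContMDiffAt.comp (t, x₀) (g := fun r : ℝ => r - s) (f := Prod.fst)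
          (contDiff_id.sub contDiff_const).contMDiff.contMDiffAt contMDiffAt_fst
      · exact ContMDiffAt.comp (t, x₀) (g := fun p : ℝ × M => Φ p.1 p.2)
          (f := fun p : ℝ × M => (s, p.2)) hsS (contMDiffAt_const.prodMk contMDiffAt_snd)
    have h4 := ContMDiffAt.comp (t, x₀) (g := fun p : ℝ × M => Φ p.1 p.2)
      (f := fun p : ℝ × M => (p.1 - s, Φ s p.2)) hs h3
    refine h4.congr_of_eventuallyEq (Eventually.of_forall fun p => ?_)
    simp only [Function.comp_apply, ← hΦ.add_apply hX, sub_add_cancel]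
  have huniv : S = univ := IsClopen.eq_univ ⟨hclosed, hopen⟩ ⟨0, hΦ.contMDiffAt_zero hX k hk x₀⟩
  exact (huniv ▸ mem_univ t₀ : t₀ ∈ S)

end Flow

/-! ### Linear algebra of cosymplectic vector spaces -/

section LinearAlgebra

variable {V : Type*} [AddCommGroup V] [Module ℝ V]

/-- If `g w ≠ 0` then `w` is a basis; putting `u` in a slot where its coordinate is nonzero
multiplies `g w` by that coordinate. -/
theorem AlternatingMap.eq_zero_of_forall_update_eq_zero {ι : Type*} [Fintype ι] [DecidableEq ι]
    (g : V [⋀^ι]→ₗ[ℝ] ℝ) (hι : Fintype.card ι = Module.finrank ℝ V) [Nonempty ι] {u : V}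
    (hu : u ≠ 0) (hg : ∀ w i, g (Function.update w i u) = 0) : g = 0 := by
  ext w
  by_contra hw
  have hli : LinearIndependent ℝ w := by
    by_contra h
    exact hw (g.map_linearDependent w h)
  let b := basisOfLinearIndependentOfCardEqFinrank hli hι
  have hb : ∀ i, b i = w i := fun i => by simp [b]
  obtain ⟨i, hi⟩ : ∃ i, b.repr u i ≠ 0 := by
    by_contra! h
    exact hu (b.repr.map_eq_zero_iff.1 (Finsupp.ext h))
  have h1 : g (Function.update w i u) = b.repr u i * g w := by
    conv_lhs => rw [← b.sum_repr u]
    rw [g.map_update_sum, Finset.sum_eq_single i]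
    · rw [g.map_update_smul, hb, Function.update_eq_self, smul_eq_mul]
    · intro j _ hj
      rw [g.map_update_smul, hb, g.map_update_self _ hj.symm, smul_zero]
    · simp
  exact mul_ne_zero hi hw (h1.symm.trans (hg w i))

variable [TopologicalSpace V]

/-- An alternating bilinear form as a bilinear map. -/
noncomputable def bilinOfAlternating (Ω : V [⋀^Fin 2]→L[ℝ] ℝ) : V →ₗ[ℝ] V →ₗ[ℝ] ℝ :=
  have h0 : ∀ v w x : V, Function.update ![v, w] 0 x = ![x, w] := fun v w x => by
    ext i; fin_cases i <;> rfl
  have h1 : ∀ v w x : V, Function.update ![v, w] 1 x = ![v, x] := fun v w x => by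
    ext i; fin_cases i <;> rfl
  LinearMap.mk₂ ℝ (fun v w => Ω ![v, w])
    (fun v v' w => by simpa only [h0] using Ω.map_update_add ![v, w] 0 v v')
    (fun c v w => by simpa only [h0] using Ω.map_update_smul ![v, w] 0 c v)
    (fun v w w' => by simpa only [h1] using Ω.map_update_add ![v, w] 1 w w')
    (fun c v w => by simpa only [h1] using Ω.map_update_smul ![v, w] 1 c w)

theorem bilinOfAlternating_apply (Ω : V [⋀^Fin 2]→L[ℝ] ℝ) (v w : V) :
    bilinOfAlternating Ω v w = Ω ![v, w] := rfl

theorem alternating_swap (Ω : V [⋀^Fin 2]→L[ℝ] ℝ) (v w : V) : Ω ![v, w] = -Ω ![w, v] := by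
  have h := Ω.toAlternatingMap.map_swap ![w, v] (i := 0) (j := 1) (by simp)
  have h2 : (![w, v] ∘ Equiv.swap (0 : Fin 2) 1) = ![v, w] := by
    ext i; fin_cases i <;> simp
  rw [h2] at h
  exact h

theorem alternating_self (Ω : V [⋀^Fin 2]→L[ℝ] ℝ) (v : V) : Ω ![v, v] = 0 := by
  linarith [alternating_swap Ω v v]

theorem exists_pair_index {n : ℕ} {j : Fin (2 * n + 1)} (hj : j ≠ 0) :
    ∃ i : Fin n, j = ⟨2 * i + 1, by omega⟩ ∨ j = ⟨2 * i + 2, by omega⟩ := by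
  have hj' : (j : ℕ) ≠ 0 := fun h => hj (Fin.ext h)
  refine ⟨⟨(j - 1) / 2, by omega⟩, ?_⟩
  simp only [Fin.ext_iff]
  omega

/-- The function `v ↦ η(v₀) Ω(v₁, v₂) ⋯ Ω(v_{2n-1}, v_{2n})`. -/
noncomputable def tensorTopFun (n : ℕ) (η : V →L[ℝ] ℝ) (Ω : V [⋀^Fin 2]→L[ℝ] ℝ)
    (v : Fin (2 * n + 1) → V) : ℝ :=
  η (v 0) * ∏ i : Fin n, Ω ![v ⟨2 * i + 1, by omega⟩, v ⟨2 * i + 2, by omega⟩]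

/-- Each argument occurs in exactly one factor. The existential form yields additivity and
homogeneity of `tensorTop` together. -/
theorem exists_linearMap_tensorTopFun_update (n : ℕ) (η : V →L[ℝ] ℝ) (Ω : V [⋀^Fin 2]→L[ℝ] ℝ)
    (v : Fin (2 * n + 1) → V) (j : Fin (2 * n + 1)) :
    ∃ L : V →ₗ[ℝ] ℝ, ∀ x, tensorTopFun n η Ω (Function.update v j x) = L x := by
  by_cases hj : j = 0
  · subst hj
    refine ⟨(∏ i : Fin n, Ω ![v ⟨2 * i + 1, by omega⟩, v ⟨2 * i + 2, by omega⟩]) •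
      (η : V →ₗ[ℝ] ℝ), fun x => ?_⟩
    have h : ∀ (m : ℕ) (hm : m + 1 < 2 * n + 1),
        Function.update v 0 x ⟨m + 1, hm⟩ = v ⟨m + 1, hm⟩ := fun m hm =>
      Function.update_of_ne (by simp [Fin.ext_iff]) _ _
    simp only [tensorTopFun, Function.update_self, h, LinearMap.smul_apply, smul_eq_mul,
      ContinuousLinearMap.coe_coe]
    ring
  · obtain ⟨i₀, hi₀⟩ := exists_pair_index hj
    have h0 : ∀ x, Function.update v j x 0 = v 0 := fun x => Function.update_of_ne (Ne.symm hj) _ _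
    have hi : ∀ x, ∀ i ∈ Finset.univ.erase i₀,
        Ω ![Function.update v j x ⟨2 * i + 1, by omega⟩,
          Function.update v j x ⟨2 * i + 2, by omega⟩] =
        Ω ![v ⟨2 * i + 1, by omega⟩, v ⟨2 * i + 2, by omega⟩] := by
      intro x i hi
      have hne : (i : ℕ) ≠ i₀ := fun h => (Finset.mem_erase.1 hi).1 (Fin.ext h)
      rw [Function.update_of_ne, Function.update_of_ne]
      all_goals
        rcases hi₀ with h | h <;> rw [h] <;> simp only [ne_eq, Fin.mk.injEq] <;> omega
    have hprod : ∀ x, tensorTopFun n η Ω (Function.update v j x) =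
        (η (v 0) * ∏ i ∈ Finset.univ.erase i₀,
          Ω ![v ⟨2 * i + 1, by omega⟩, v ⟨2 * i + 2, by omega⟩]) *
        Ω ![Function.update v j x ⟨2 * i₀ + 1, by omega⟩,
          Function.update v j x ⟨2 * i₀ + 2, by omega⟩] := by
      intro x
      rw [tensorTopFun, h0, ← Finset.prod_erase_mul _ _ (Finset.mem_univ i₀),
        Finset.prod_congr rfl (hi x), mul_assoc]
    rcases hi₀ with h | h
    · refine ⟨(η (v 0) * ∏ i ∈ Finset.univ.erase i₀,
          Ω ![v ⟨2 * i + 1, by omega⟩, v ⟨2 * i + 2, by omega⟩]) •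
          (bilinOfAlternating Ω).flip (v ⟨2 * i₀ + 2, by omega⟩), fun x => ?_⟩
      have h1 : Function.update v j x ⟨2 * i₀ + 1, by omega⟩ = x := by
        rw [← h, Function.update_self]
      have h2 : Function.update v j x ⟨2 * i₀ + 2, by omega⟩ = v ⟨2 * i₀ + 2, by omega⟩ :=
        Function.update_of_ne (by rw [h]; simp) _ _
      rw [hprod, h1, h2]
      rfl
    · refine ⟨(η (v 0) * ∏ i ∈ Finset.univ.erase i₀,
          Ω ![v ⟨2 * i + 1, by omega⟩, v ⟨2 * i + 2, by omega⟩]) •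
          bilinOfAlternating Ω (v ⟨2 * i₀ + 1, by omega⟩), fun x => ?_⟩
      have h1 : Function.update v j x ⟨2 * i₀ + 2, by omega⟩ = x := by
        rw [← h, Function.update_self]
      have h2 : Function.update v j x ⟨2 * i₀ + 1, by omega⟩ = v ⟨2 * i₀ + 1, by omega⟩ :=
        Function.update_of_ne (by rw [h]; simp) _ _
      rw [hprod, h1, h2]
      rfl

/-- The multilinear map `v ↦ η(v₀) Ω(v₁, v₂) ⋯ Ω(v_{2n-1}, v_{2n})`. -/
noncomputable def tensorTop (n : ℕ) (η : V →L[ℝ] ℝ) (Ω : V [⋀^Fin 2]→L[ℝ] ℝ) :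
    MultilinearMap ℝ (fun _ : Fin (2 * n + 1) => V) ℝ :=
  MultilinearMap.mk' (tensorTopFun n η Ω)
    (fun v j x y => by
      obtain ⟨L, hL⟩ := exists_linearMap_tensorTopFun_update n η Ω v j
      simp only [hL, map_add])
    (fun v j c x => by
      obtain ⟨L, hL⟩ := exists_linearMap_tensorTopFun_update n η Ω v j
      simp only [hL, map_smul])

theorem wedgeTop_eq_alternatization (n : ℕ) (η : V →L[ℝ] ℝ) (Ω : V [⋀^Fin 2]→L[ℝ] ℝ)
    (v : Fin (2 * n + 1) → V) :
    wedgeTop n η Ω v = (1 / 2 ^ n : ℝ) * MultilinearMap.alternatization (tensorTop n η Ω) v := by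
  rw [wedgeTop, MultilinearMap.alternatization_apply]
  congr 1
  refine Finset.sum_congr rfl fun σ _ => ?_
  rw [Units.smul_def, zsmul_eq_mul]
  rfl

theorem tensorTopFun_eq_zero {n : ℕ} {η : V →L[ℝ] ℝ} {Ω : V [⋀^Fin 2]→L[ℝ] ℝ} {u : V}
    (hη : η u = 0) (hΩ : ∀ w, Ω ![u, w] = 0) {v : Fin (2 * n + 1) → V} {j : Fin (2 * n + 1)}
    (hj : v j = u) : tensorTopFun n η Ω v = 0 := by
  by_cases h0 : j = 0
  · rw [tensorTopFun, ← h0, hj, hη, zero_mul]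
  · obtain ⟨i, hi⟩ := exists_pair_index h0
    refine mul_eq_zero_of_right _ (Finset.prod_eq_zero (Finset.mem_univ i) ?_)
    rcases hi with hi | hi
    · rw [← hi, hj, hΩ]
    · rw [← hi, hj, alternating_swap, hΩ, neg_zero]

/-- A vector killed by `η` and `Ω` annihilates every term of the alternatization in which it
appears; were it nonzero, the top form would vanish identically. -/
theorem eq_zero_of_wedgeTop_ne_zero {n : ℕ} {η : V →L[ℝ] ℝ} {Ω : V [⋀^Fin 2]→L[ℝ] ℝ}
    (hdim : Module.finrank ℝ V = 2 * n + 1) (hvol : ∃ v, wedgeTop n η Ω v ≠ 0) {u : V}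
    (hη : η u = 0) (hΩ : ∀ w, Ω ![u, w] = 0) : u = 0 := by
  by_contra hu
  obtain ⟨v, hv⟩ := hvol
  refine hv ?_
  rw [wedgeTop_eq_alternatization, AlternatingMap.eq_zero_of_forall_update_eq_zero
    (MultilinearMap.alternatization (tensorTop n η Ω)) (by simp [hdim]) hu]
  · simp
  · intro w i
    rw [MultilinearMap.alternatization_apply]
    refine Finset.sum_eq_zero fun σ _ => ?_
    have : (tensorTop n η Ω).domDomCongr σ (Function.update w i u) = 0 :=
      tensorTopFun_eq_zero hη hΩ (v := fun j => Function.update w i u (σ j)) (j := σ.symm i)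
        (by simp)
    rw [this, smul_zero]

/-- A skew-symmetric matrix `A` of odd size has `det A = -det A`, hence a kernel. -/
theorem exists_ne_zero_forall_alternating_eq_zero {n : ℕ} (Ω : V [⋀^Fin 2]→L[ℝ] ℝ)
    (hdim : Module.finrank ℝ V = 2 * n + 1) : ∃ u : V, u ≠ 0 ∧ ∀ w, Ω ![u, w] = 0 := by
  have : FiniteDimensional ℝ V := Module.finite_of_finrank_eq_succ hdim
  let b := Module.finBasisOfFinrankEq ℝ V hdim
  let A : Matrix (Fin (2 * n + 1)) (Fin (2 * n + 1)) ℝ := fun i j => Ω ![b i, b j]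
  have hA : A.transpose = -A := by
    ext i j
    exact alternating_swap Ω (b j) (b i)
  have hdet : A.det = 0 := by
    have h := A.det_transpose
    rw [hA, Matrix.det_neg, Fintype.card_fin, pow_succ, pow_mul] at h
    norm_num at h
    linarith
  obtain ⟨c, hc, hcA⟩ := Matrix.exists_vecMul_eq_zero_iff.2 hdet
  refine ⟨∑ i, c i • b i, fun h => hc ?_, fun w => ?_⟩
  · exact funext fun i => Fintype.linearIndependent_iff.1 b.linearIndependent c h i
  · rw [← bilinOfAlternating_apply]
    have : bilinOfAlternating Ω (∑ i, c i • b i) = 0 := b.ext fun j => by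
      have := congrFun hcA j
      simp only [map_sum, map_smul, LinearMap.sum_apply, LinearMap.smul_apply]
      exact this
    rw [this, LinearMap.zero_apply]

/-- A nonzero vector in the kernel of `Ω` cannot also be in the kernel of `η`, so it can be
rescaled. -/
theorem exists_reeb_vector {n : ℕ} {η : V →L[ℝ] ℝ} {Ω : V [⋀^Fin 2]→L[ℝ] ℝ}
    (hdim : Module.finrank ℝ V = 2 * n + 1) (hvol : ∃ v, wedgeTop n η Ω v ≠ 0) :
    ∃ R : V, (∀ w, Ω ![R, w] = 0) ∧ η R = 1 := by
  obtain ⟨u, hu, huΩ⟩ := exists_ne_zero_forall_alternating_eq_zero Ω hdim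
  have hηu : η u ≠ 0 := fun h => hu (eq_zero_of_wedgeTop_ne_zero hdim hvol h huΩ)
  refine ⟨(η u)⁻¹ • u, fun w => ?_, ?_⟩
  · rw [← bilinOfAlternating_apply, map_smul, LinearMap.smul_apply, bilinOfAlternating_apply, huΩ,
      smul_zero]
  · rw [map_smul, smul_eq_mul, inv_mul_cancel₀ hηu]

theorem reeb_vector_unique {n : ℕ} {η : V →L[ℝ] ℝ} {Ω : V [⋀^Fin 2]→L[ℝ] ℝ}
    (hdim : Module.finrank ℝ V = 2 * n + 1) (hvol : ∃ v, wedgeTop n η Ω v ≠ 0) {R R' : V}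
    (hR : ∀ w, Ω ![R, w] = 0) (hηR : η R = 1) (hR' : ∀ w, Ω ![R', w] = 0) (hηR' : η R' = 1) :
    R = R' := by
  rw [← sub_eq_zero]
  refine eq_zero_of_wedgeTop_ne_zero hdim hvol (by rw [map_sub, hηR, hηR', sub_self]) fun w => ?_
  rw [← bilinOfAlternating_apply, map_sub, LinearMap.sub_apply, bilinOfAlternating_apply,
    bilinOfAlternating_apply, hR, hR', sub_self]

end LinearAlgebra

/-! ### Derivatives of maps between manifolds as maps between model spaces -/

section ModelDerivative

variable {E : Type*} [NormedAddCommGroup E] [NormedSpace ℝ E]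
  {M : Type*} [TopologicalSpace M] [ChartedSpace E M]
  {E' : Type*} [NormedAddCommGroup E'] [NormedSpace ℝ E']
  {M' : Type*} [TopologicalSpace M'] [ChartedSpace E' M']
  {E'' : Type*} [NormedAddCommGroup E''] [NormedSpace ℝ E'']
  {M'' : Type*} [TopologicalSpace M''] [ChartedSpace E'' M'']

variable (E E') in
/-- The derivative of a map between manifolds, where all tangent spaces are identified with the
model spaces. -/
noncomputable def modelDeriv (f : M → M') (x : M) : E →L[ℝ] E' :=
  mfderiv 𝓘(ℝ, E) 𝓘(ℝ, E') f x

theorem modelDeriv_comp (x : M) {g : M' → M''} {f : M → M'}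
    (hg : MDifferentiableAt 𝓘(ℝ, E') 𝓘(ℝ, E'') g (f x))
    (hf : MDifferentiableAt 𝓘(ℝ, E) 𝓘(ℝ, E') f x) :
    modelDeriv E E'' (fun x => g (f x)) x = (modelDeriv E' E'' g (f x)).comp (modelDeriv E E' f x) :=
  mfderiv_comp x hg hf

theorem modelDeriv_congr {f g : M → M'} {x : M} (h : f =ᶠ[𝓝 x] g) :
    modelDeriv E E' f x = modelDeriv E E' g x :=
  h.mfderiv_eq

theorem modelDeriv_id (x : M) : modelDeriv E E (fun x : M => x) x = ContinuousLinearMap.id ℝ E :=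
  mfderiv_id

theorem modelDeriv_const (c : M') (x : M) : modelDeriv E E' (fun _ : M => c) x = 0 :=
  mfderiv_const

theorem modelDeriv_eq_fderiv (f : E → E') (x : E) : modelDeriv E E' f x = fderiv ℝ f x :=
  mfderiv_eq_fderiv

variable [IsManifold 𝓘(ℝ, E) ∞ M]

theorem modelDeriv_extChartAt_modelDeriv_symm {x₀ : M} {y : E}
    (hy : y ∈ (extChartAt 𝓘(ℝ, E) x₀).target) (v : E) :
    modelDeriv E E (extChartAt 𝓘(ℝ, E) x₀) ((extChartAt 𝓘(ℝ, E) x₀).symm y)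
      (modelDeriv E E (extChartAt 𝓘(ℝ, E) x₀).symm y v) = v :=
  mfderiv_extChartAt_mfderiv_symm hy v

theorem modelDeriv_symm_modelDeriv_extChartAt {x₀ x : M}
    (hx : x ∈ (extChartAt 𝓘(ℝ, E) x₀).source) (v : E) :
    modelDeriv E E (extChartAt 𝓘(ℝ, E) x₀).symm (extChartAt 𝓘(ℝ, E) x₀ x)
      (modelDeriv E E (extChartAt 𝓘(ℝ, E) x₀) x v) = v := by
  have h : modelDeriv E E (extChartAt 𝓘(ℝ, E) x₀).symm (extChartAt 𝓘(ℝ, E) x₀ x)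
      (modelDeriv E E (extChartAt 𝓘(ℝ, E) x₀)
        ((extChartAt 𝓘(ℝ, E) x₀).symm (extChartAt 𝓘(ℝ, E) x₀ x)) v) = v :=
    mfderiv_symm_mfderiv_extChartAt ((extChartAt 𝓘(ℝ, E) x₀).map_source hx) v
  rwa [(extChartAt 𝓘(ℝ, E) x₀).left_inv hx] at h

end ModelDerivative

/-! ### Cosymplectic structures in charts -/

section CosymplecticCharts

variable {E : Type*} [NormedAddCommGroup E] [NormedSpace ℝ E]
  {M : Type*} [TopologicalSpace M] [ChartedSpace E M]

variable (E) in
/-- Covectors as alternating forms of degree one. -/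
noncomputable def covectorEquiv : (E →L[ℝ] ℝ) ≃ₗᵢ[ℝ] (E [⋀^Fin 1]→L[ℝ] ℝ) :=
  ContinuousAlternatingMap.ofSubsingletonLIE (0 : Fin 1)

/-- An alternating bilinear form as a curried continuous bilinear map. -/
noncomputable def formPairing (A : E [⋀^Fin 2]→L[ℝ] ℝ) : E →L[ℝ] E →L[ℝ] ℝ :=
  (covectorEquiv E).symm.toContinuousLinearEquiv.toContinuousLinearMap.comp A.curryLeft

theorem formPairing_apply (A : E [⋀^Fin 2]→L[ℝ] ℝ) (v w : E) : formPairing A v w = A ![v, w] :=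
  congrArg A (funext fun i => by fin_cases i <;> rfl)

theorem contDiff_formPairing [FiniteDimensional ℝ E] : ContDiff ℝ ∞ (formPairing (E := E)) := by
  refine contDiff_clm_apply_iff.2 fun v => contDiff_clm_apply_iff.2 fun w => ?_
  simp only [formPairing_apply]
  exact (ContinuousAlternatingMap.apply ℝ E ℝ ![v, w]).contDiff

/-- The coordinate expression of a `2`-form as a field of bilinear maps. -/
noncomputable def twoFormInChart (Ω : M → E [⋀^Fin 2]→L[ℝ] ℝ) (x₀ : M) (y : E) :
    E →L[ℝ] E →L[ℝ] ℝ :=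
  formPairing (formInChart Ω x₀ y)

/-- The coordinate expression of a `1`-form as a field of covectors. -/
noncomputable def oneFormInChart (η : M → E →L[ℝ] ℝ) (x₀ : M) (y : E) : E →L[ℝ] ℝ :=
  (covectorEquiv E).symm
    (formInChart (oneForm η) x₀ y)

theorem twoFormInChart_apply (Ω : M → E [⋀^Fin 2]→L[ℝ] ℝ) (x₀ : M) (y v w : E) :
    twoFormInChart Ω x₀ y v w = Ω ((extChartAt 𝓘(ℝ, E) x₀).symm y)
      ![modelDeriv E E (extChartAt 𝓘(ℝ, E) x₀).symm y v,
        modelDeriv E E (extChartAt 𝓘(ℝ, E) x₀).symm y w] := by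
  rw [twoFormInChart, formPairing_apply]
  refine congrArg (Ω _) (funext fun i => ?_)
  fin_cases i <;> rfl

theorem oneFormInChart_apply (η : M → E →L[ℝ] ℝ) (x₀ : M) (y v : E) :
    oneFormInChart η x₀ y v = η ((extChartAt 𝓘(ℝ, E) x₀).symm y)
      (modelDeriv E E (extChartAt 𝓘(ℝ, E) x₀).symm y v) := rfl

section

variable [IsManifold 𝓘(ℝ, E) ∞ M]

theorem twoFormInChart_extChartAt (Ω : M → E [⋀^Fin 2]→L[ℝ] ℝ) {x₀ x : M}
    (hx : x ∈ (extChartAt 𝓘(ℝ, E) x₀).source) (v w : E) :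
    twoFormInChart Ω x₀ (extChartAt 𝓘(ℝ, E) x₀ x) (modelDeriv E E (extChartAt 𝓘(ℝ, E) x₀) x v)
      (modelDeriv E E (extChartAt 𝓘(ℝ, E) x₀) x w) = Ω x ![v, w] := by
  rw [twoFormInChart_apply, modelDeriv_symm_modelDeriv_extChartAt hx,
    modelDeriv_symm_modelDeriv_extChartAt hx, (extChartAt 𝓘(ℝ, E) x₀).left_inv hx]

theorem oneFormInChart_extChartAt (η : M → E →L[ℝ] ℝ) {x₀ x : M}
    (hx : x ∈ (extChartAt 𝓘(ℝ, E) x₀).source) (v : E) :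
    oneFormInChart η x₀ (extChartAt 𝓘(ℝ, E) x₀ x) (modelDeriv E E (extChartAt 𝓘(ℝ, E) x₀) x v) =
      η x v := by
  rw [oneFormInChart_apply, modelDeriv_symm_modelDeriv_extChartAt hx,
    (extChartAt 𝓘(ℝ, E) x₀).left_inv hx]

end

theorem contDiffOn_twoFormInChart [FiniteDimensional ℝ E] {Ω : M → E [⋀^Fin 2]→L[ℝ] ℝ}
    (hΩ : IsSmoothForm Ω) (x₀ : M) :
    ContDiffOn ℝ ∞ (twoFormInChart Ω x₀) (extChartAt 𝓘(ℝ, E) x₀).target :=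
  contDiff_formPairing.comp_contDiffOn (hΩ x₀)

theorem contDiffOn_oneFormInChart {η : M → E →L[ℝ] ℝ} (hη : IsSmoothForm (oneForm η)) (x₀ : M) :
    ContDiffOn ℝ ∞ (oneFormInChart η x₀) (extChartAt 𝓘(ℝ, E) x₀).target :=
  (covectorEquiv E).symm.contDiff.comp_contDiffOn
    (hη x₀)

/-- The exterior derivative of a `1`-form is its antisymmetrized derivative. -/
theorem fderiv_oneFormInChart_symm {η : M → E →L[ℝ] ℝ} (hη : IsSmoothForm (oneForm η))
    (hcl : IsClosedForm (oneForm η)) {x₀ : M} {y : E} (hy : y ∈ (extChartAt 𝓘(ℝ, E) x₀).target)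
    (v w : E) :
    fderiv ℝ (oneFormInChart η x₀) y v w = fderiv ℝ (oneFormInChart η x₀) y w v := by
  have hd : DifferentiableAt ℝ (formInChart (oneForm η) x₀) y :=
    ((hη x₀).contDiffAt ((isOpen_extChartAt_target x₀).mem_nhds hy)).differentiableAt (by simp)
  have hd' : DifferentiableAt ℝ (oneFormInChart η x₀) y :=
    ((contDiffOn_oneFormInChart hη x₀).contDiffAt
      ((isOpen_extChartAt_target x₀).mem_nhds hy)).differentiableAt (by simp)
  have h := extDeriv_apply hd ![v, w]
  rw [hcl x₀ y hy] at h
  have e1 : ∀ a b : E, fderiv ℝ (fun z => formInChart (oneForm η) x₀ z fun _ => a) y b =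
      fderiv ℝ (oneFormInChart η x₀) y b a := by
    intro a b
    have : (fun z => formInChart (oneForm η) x₀ z fun _ => a) =
      fun z => oneFormInChart η x₀ z a := rfl
    rw [this, fderiv_clm_apply hd' (differentiableAt_const a)]
    simp
  have r0 : (Fin.removeNth 0 ![v, w] : Fin 1 → E) = fun _ => w := by
    ext i; fin_cases i; rfl
  have r1 : (Fin.removeNth 1 ![v, w] : Fin 1 → E) = fun _ => v := by
    ext i; fin_cases i; rfl
  rw [Fin.sum_univ_two, r0, r1, e1, e1] at h
  simp at h
  linarith

/-- This is `dΩ(a, b, c)` as the alternating sum over the vector used for differentiation. -/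
theorem fderiv_twoFormInChart_cyclic [FiniteDimensional ℝ E] {Ω : M → E [⋀^Fin 2]→L[ℝ] ℝ}
    (hΩ : IsSmoothForm Ω) (hcl : IsClosedForm Ω) {x₀ : M} {y : E} (hy : y ∈ (extChartAt 𝓘(ℝ, E) x₀).target)
    (a b c : E) :
    fderiv ℝ (twoFormInChart Ω x₀) y a b c - fderiv ℝ (twoFormInChart Ω x₀) y b a c +
      fderiv ℝ (twoFormInChart Ω x₀) y c a b = 0 := by
  have hd : DifferentiableAt ℝ (formInChart Ω x₀) y :=
    ((hΩ x₀).contDiffAt ((isOpen_extChartAt_target x₀).mem_nhds hy)).differentiableAt (by simp)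
  have hd' : DifferentiableAt ℝ (twoFormInChart Ω x₀) y :=
    ((contDiffOn_twoFormInChart hΩ x₀).contDiffAt
      ((isOpen_extChartAt_target x₀).mem_nhds hy)).differentiableAt (by simp)
  have h := extDeriv_apply hd ![a, b, c]
  rw [hcl x₀ y hy] at h
  have e1 : ∀ u v w : E, fderiv ℝ (fun z => formInChart Ω x₀ z ![v, w]) y u =
      fderiv ℝ (twoFormInChart Ω x₀) y u v w := by
    intro u v w
    have : (fun z => formInChart Ω x₀ z ![v, w]) = fun z => twoFormInChart Ω x₀ z v w :=
      funext fun z => (formPairing_apply _ v w).symm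
    rw [this, fderiv_clm_apply (hd'.clm_apply (differentiableAt_const v)) (differentiableAt_const w),
      fderiv_clm_apply hd' (differentiableAt_const v)]
    simp
  have r0 : (Fin.removeNth 0 ![a, b, c] : Fin 2 → E) = ![b, c] := by
    ext i; fin_cases i <;> rfl
  have r1 : (Fin.removeNth 1 ![a, b, c] : Fin 2 → E) = ![a, c] := by
    ext i; fin_cases i <;> rfl
  have r2 : (Fin.removeNth 2 ![a, b, c] : Fin 2 → E) = ![a, b] := by
    ext i; fin_cases i <;> rfl
  rw [Fin.sum_univ_three, r0, r1, r2, e1, e1, e1] at h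
  simp at h
  linarith

end CosymplecticCharts

/-! ### The Reeb vector field -/

section Reeb

variable {E : Type*} [NormedAddCommGroup E] [NormedSpace ℝ E]
  {M : Type*} [TopologicalSpace M] [ChartedSpace E M]
  {n : ℕ} {Ω : M → E [⋀^Fin 2]→L[ℝ] ℝ} {η : M → E →L[ℝ] ℝ}

theorem IsCosymplectic.reebField_spec (hM : IsCosymplectic n Ω η) (x : M) :
    (∀ w : E, Ω x ![reebField Ω η x, w] = 0) ∧ η x (reebField Ω η x) = 1 :=
  Classical.epsilon_spec (p := fun R : TangentSpace 𝓘(ℝ, E) x =>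
    (∀ v : TangentSpace 𝓘(ℝ, E) x, Ω x ![R, v] = 0) ∧ η x R = 1)
    (exists_reeb_vector (V := E) hM.dim_eq (hM.volume x))

theorem IsCosymplectic.eq_zero (hM : IsCosymplectic n Ω η) (x : M) {u : E} (hη : η x u = 0)
    (hΩ : ∀ w : E, Ω x ![u, w] = 0) : u = 0 :=
  eq_zero_of_wedgeTop_ne_zero (V := E) hM.dim_eq (hM.volume x) hη hΩ

theorem IsCosymplectic.eq_reebField (hM : IsCosymplectic n Ω η) (x : M) {R : E}
    (hR : ∀ w : E, Ω x ![R, w] = 0) (hηR : η x R = 1) : R = reebField Ω η x :=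
  reeb_vector_unique (V := E) hM.dim_eq (hM.volume x) hR hηR (hM.reebField_spec x).1
    (hM.reebField_spec x).2

variable [IsManifold 𝓘(ℝ, E) ∞ M]

theorem modelDeriv_symm_fieldInChart (X : M → E) {x₀ : M} {y : E}
    (hy : y ∈ (extChartAt 𝓘(ℝ, E) x₀).target) :
    modelDeriv E E (extChartAt 𝓘(ℝ, E) x₀).symm y (fieldInChart X x₀ y) =
      X ((extChartAt 𝓘(ℝ, E) x₀).symm y) :=
  mfderiv_symm_mfderiv_extChartAt hy _

theorem IsCosymplectic.twoFormInChart_reebField (hM : IsCosymplectic n Ω η) {x₀ : M} {y : E}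
    (hy : y ∈ (extChartAt 𝓘(ℝ, E) x₀).target) (w : E) :
    twoFormInChart Ω x₀ y (fieldInChart (reebField Ω η) x₀ y) w = 0 := by
  rw [twoFormInChart_apply, modelDeriv_symm_fieldInChart (reebField Ω η) hy]
  exact (hM.reebField_spec _).1 _

theorem IsCosymplectic.oneFormInChart_reebField (hM : IsCosymplectic n Ω η) {x₀ : M} {y : E}
    (hy : y ∈ (extChartAt 𝓘(ℝ, E) x₀).target) :
    oneFormInChart η x₀ y (fieldInChart (reebField Ω η) x₀ y) = 1 := by
  rw [oneFormInChart_apply, modelDeriv_symm_fieldInChart (reebField Ω η) hy]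
  exact (hM.reebField_spec _).2

/-- The bilinear form `Ω + η ⊗ η` in a chart. -/
noncomputable def flatInChart (Ω : M → E [⋀^Fin 2]→L[ℝ] ℝ) (η : M → E →L[ℝ] ℝ) (x₀ : M) (y : E) :
    E →L[ℝ] E →L[ℝ] ℝ :=
  twoFormInChart Ω x₀ y + (oneFormInChart η x₀ y).smulRight (oneFormInChart η x₀ y)

/-- Pairing the image of `u` with `u` itself leaves `η(u)²`, since `Ω(u, u) = 0`; hence `η(u) = 0`
and then `i_u Ω = 0`. -/
theorem IsCosymplectic.flatInChart_injective (hM : IsCosymplectic n Ω η) {x₀ : M} {y : E}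
    (hy : y ∈ (extChartAt 𝓘(ℝ, E) x₀).target) : Function.Injective (flatInChart Ω η x₀ y) := by
  rw [injective_iff_map_eq_zero]
  intro u hu
  have h : ∀ w, twoFormInChart Ω x₀ y u w + oneFormInChart η x₀ y u * oneFormInChart η x₀ y w = 0 :=
    fun w => DFunLike.congr_fun hu w
  have h0 : twoFormInChart Ω x₀ y u u = 0 := by
    rw [twoFormInChart_apply]; exact alternating_self (Ω _) _
  have hη : oneFormInChart η x₀ y u = 0 := by
    have := h u
    rw [h0, zero_add] at this
    exact mul_self_eq_zero.1 this
  have hΩ : ∀ w, twoFormInChart Ω x₀ y u w = 0 := fun w => by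
    have := h w
    rwa [hη, zero_mul, add_zero] at this
  have hz : modelDeriv E E (extChartAt 𝓘(ℝ, E) x₀).symm y u = 0 := by
    refine hM.eq_zero ((extChartAt 𝓘(ℝ, E) x₀).symm y) hη fun w => ?_
    have h1 := hΩ (modelDeriv E E (extChartAt 𝓘(ℝ, E) x₀) ((extChartAt 𝓘(ℝ, E) x₀).symm y) w)
    rw [twoFormInChart_apply] at h1
    have h2 := modelDeriv_symm_modelDeriv_extChartAt ((extChartAt 𝓘(ℝ, E) x₀).map_target hy) w
    rw [(extChartAt 𝓘(ℝ, E) x₀).right_inv hy] at h2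
    rwa [h2] at h1
  rw [← modelDeriv_extChartAt_modelDeriv_symm hy u, hz, map_zero]

theorem IsCosymplectic.isInvertible_flatInChart [FiniteDimensional ℝ E]
    (hM : IsCosymplectic n Ω η) {x₀ : M} {y : E} (hy : y ∈ (extChartAt 𝓘(ℝ, E) x₀).target) :
    (flatInChart Ω η x₀ y).IsInvertible := by
  have hfin : Module.finrank ℝ E = Module.finrank ℝ (E →L[ℝ] ℝ) := by
    rw [← LinearEquiv.finrank_eq (LinearMap.toContinuousLinearMap (𝕜 := ℝ) (E := E) (F' := ℝ))]
    simp
  exact ⟨(LinearEquiv.ofInjectiveOfFinrankEq (flatInChart Ω η x₀ y : E →ₗ[ℝ] (E →L[ℝ] ℝ))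
    (hM.flatInChart_injective hy) hfin).toContinuousLinearEquiv, by ext; rfl⟩

/-- `flatInChart` sends `R` to `i_R Ω + η(R) η = η`, so `R` is the inverse map applied to `η`, and
inversion of linear maps is smooth. -/
theorem IsCosymplectic.isSmoothField_reebField [FiniteDimensional ℝ E]
    (hM : IsCosymplectic n Ω η) : IsSmoothField (reebField Ω η) := by
  intro x₀ y hy
  have hopen := (isOpen_extChartAt_target (I := 𝓘(ℝ, E)) x₀).mem_nhds hy
  have hη := (contDiffOn_oneFormInChart hM.smooth_eta x₀).contDiffAt hopen
  have hflat : ContDiffAt ℝ ∞ (flatInChart Ω η x₀) y :=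
    ((contDiffOn_twoFormInChart hM.smooth_omega x₀).contDiffAt hopen).add (hη.smulRight hη)
  obtain ⟨e, he⟩ := hM.isInvertible_flatInChart hy
  have hinv : ContDiffAt ℝ ∞ (fun z => (flatInChart Ω η x₀ z).inverse) y := by
    refine ContDiffAt.comp y (g := ContinuousLinearMap.inverse) ?_ hflat
    rw [← he]
    exact contDiffAt_map_inverse e
  refine ((hinv.clm_apply hη).congr_of_eventuallyEq ?_).contDiffWithinAt
  filter_upwards [hopen] with z hz
  refine (((hM.isInvertible_flatInChart hz).inverse_apply_eq).2 ?_).symm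
  ext w
  change _ = twoFormInChart Ω x₀ z _ w + oneFormInChart η x₀ z _ * oneFormInChart η x₀ z w
  rw [hM.twoFormInChart_reebField hz, hM.oneFormInChart_reebField hz, zero_add, one_mul]

end Reeb

/-! ### Lie derivatives along a local flow in coordinates -/

section LocalInvariance

variable {E : Type*} [NormedAddCommGroup E] [NormedSpace ℝ E] {f : ℝ × E → E} {Y : E → E} {y₀ : E}

theorem hasDerivAt_curve_of_flow (hf : ContDiffAt ℝ 2 f (0, y₀))
    (hY : ∀ᶠ y in 𝓝 y₀, fderiv ℝ f (0, y) (1, 0) = Y y) :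
    HasDerivAt (fun s => f (s, y₀)) (Y y₀) 0 := by
  rw [← hY.self_of_nhds]
  exact (hf.differentiableAt (by simp)).hasFDerivAt.comp_hasDerivAt (0 : ℝ)
    ((hasDerivAt_id (0 : ℝ)).prodMk (hasDerivAt_const (0 : ℝ) y₀))

/-- Symmetry of second derivatives exchanges the time derivative with the spatial one. -/
theorem hasDerivAt_fderiv_of_flow (hf : ContDiffAt ℝ 2 f (0, y₀))
    (hY : ∀ᶠ y in 𝓝 y₀, fderiv ℝ f (0, y) (1, 0) = Y y) (v : E) :
    HasDerivAt (fun s => fderiv ℝ f (s, y₀) (0, v)) (fderiv ℝ Y y₀ v) 0 := by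
  have hG : DifferentiableAt ℝ (fderiv ℝ f) (0, y₀) :=
    (hf.fderiv_right (m := 1) (by norm_num)).differentiableAt (by simp)
  have h1 : HasDerivAt (fun s => fderiv ℝ f (s, y₀) (0, v))
      (fderiv ℝ (fderiv ℝ f) (0, y₀) (1, 0) (0, v)) 0 := by
    have := hG.hasFDerivAt.comp_hasDerivAt (0 : ℝ)
      ((hasDerivAt_id (0 : ℝ)).prodMk (hasDerivAt_const (0 : ℝ) y₀))
    simpa using this.clm_apply (hasDerivAt_const (0 : ℝ) ((0 : ℝ), v))
  have h2 : HasFDerivAt (fun y => fderiv ℝ f (0, y) (1, 0))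
      ((fderiv ℝ (fderiv ℝ f) (0, y₀) ∘L .inr ℝ ℝ E).flip (1, 0)) y₀ := by
    have := hG.hasFDerivAt.comp y₀ (hasFDerivAt_prodMk_right (0 : ℝ) y₀)
    simpa using this.clm_apply (hasFDerivAt_const ((1 : ℝ), (0 : E)) y₀)
  have h3 := (h2.congr_of_eventuallyEq (hY.mono fun y hy => hy.symm)).fderiv
  have hsymm := hf.isSymmSndFDerivAt (by simp)
  rw [h3]
  convert h1 using 1
  exact hsymm.eq _ _

theorem fderiv_apply_of_flow_zero (hf : ContDiffAt ℝ 2 f (0, y₀))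
    (h0 : ∀ᶠ y in 𝓝 y₀, f (0, y) = y) (v : E) : fderiv ℝ f (0, y₀) (0, v) = v := by
  have h1 := (hf.differentiableAt (by simp)).hasFDerivAt.comp y₀
    (hasFDerivAt_prodMk_right (0 : ℝ) y₀)
  have h2 : HasFDerivAt (fun y : E => y) (fderiv ℝ f (0, y₀) ∘L .inr ℝ ℝ E) y₀ :=
    h1.congr_of_eventuallyEq (h0.mono fun y hy => hy.symm)
  exact DFunLike.congr_fun (h2.unique (hasFDerivAt_id y₀)) v

/-- The derivative is `Dβ(Y) v + β(DY v)`. By closedness `Dβ(Y) v = Dβ(v) Y`, so the sum is the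
derivative of the constant `β(Y)` along `v`. -/
theorem hasDerivAt_oneForm_of_flow {β : E → E →L[ℝ] ℝ} (hβ : DifferentiableAt ℝ β y₀)
    (hf : ContDiffAt ℝ 2 f (0, y₀)) (h0 : ∀ᶠ y in 𝓝 y₀, f (0, y) = y)
    (hY : ∀ᶠ y in 𝓝 y₀, fderiv ℝ f (0, y) (1, 0) = Y y) (hYd : DifferentiableAt ℝ Y y₀)
    (hsymm : ∀ a b, fderiv ℝ β y₀ a b = fderiv ℝ β y₀ b a) (hβY : ∀ᶠ y in 𝓝 y₀, β y (Y y) = 1)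
    (v : E) : HasDerivAt (fun s => β (f (s, y₀)) (fderiv ℝ f (s, y₀) (0, v))) 0 0 := by
  have hz : f (0, y₀) = y₀ := h0.self_of_nhds
  have h1 : HasDerivAt (fun s => β (f (s, y₀))) (fderiv ℝ β y₀ (Y y₀)) 0 := by
    refine HasFDerivAt.comp_hasDerivAt (0 : ℝ) (l := β) ?_ (hasDerivAt_curve_of_flow hf hY)
    rw [hz]; exact hβ.hasFDerivAt
  have h2 := h1.clm_apply (hasDerivAt_fderiv_of_flow hf hY v)
  rw [hz, fderiv_apply_of_flow_zero hf h0] at h2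
  have h3 := (hβ.hasFDerivAt.clm_apply hYd.hasFDerivAt).congr_of_eventuallyEq
    (hβY.mono fun y hy => hy.symm)
  have h4 := DFunLike.congr_fun (h3.unique (hasFDerivAt_const (1 : ℝ) y₀)) v
  simp at h4
  refine h2.congr_deriv ?_
  rw [hsymm]
  linarith

/-- The derivative is `DB(Y)(v, w) + B(DY v, w) + B(v, DY w)`. Differentiating `B(Y, ·) = 0`
replaces the last two terms by `-DB(v)(Y, w) + DB(w)(Y, v)`, and closedness cancels the sum. -/
theorem hasDerivAt_twoForm_of_flow {B : E → E →L[ℝ] E →L[ℝ] ℝ} (hB : DifferentiableAt ℝ B y₀)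
    (hf : ContDiffAt ℝ 2 f (0, y₀)) (h0 : ∀ᶠ y in 𝓝 y₀, f (0, y) = y)
    (hY : ∀ᶠ y in 𝓝 y₀, fderiv ℝ f (0, y) (1, 0) = Y y) (hYd : DifferentiableAt ℝ Y y₀)
    (halt : ∀ a b, B y₀ a b = -B y₀ b a)
    (hcyc : ∀ a b c, fderiv ℝ B y₀ a b c - fderiv ℝ B y₀ b a c + fderiv ℝ B y₀ c a b = 0)
    (hBY : ∀ᶠ y in 𝓝 y₀, B y (Y y) = 0) (v w : E) :
    HasDerivAt (fun s => B (f (s, y₀)) (fderiv ℝ f (s, y₀) (0, v)) (fderiv ℝ f (s, y₀) (0, w)))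
      0 0 := by
  have hz : f (0, y₀) = y₀ := h0.self_of_nhds
  have h1 : HasDerivAt (fun s => B (f (s, y₀))) (fderiv ℝ B y₀ (Y y₀)) 0 := by
    refine HasFDerivAt.comp_hasDerivAt (0 : ℝ) (l := B) ?_ (hasDerivAt_curve_of_flow hf hY)
    rw [hz]; exact hB.hasFDerivAt
  have h2 := (h1.clm_apply (hasDerivAt_fderiv_of_flow hf hY v)).clm_apply
    (hasDerivAt_fderiv_of_flow hf hY w)
  rw [hz, fderiv_apply_of_flow_zero hf h0, fderiv_apply_of_flow_zero hf h0] at h2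
  have h3 := (hB.hasFDerivAt.clm_apply hYd.hasFDerivAt).congr_of_eventuallyEq
    (hBY.mono fun y hy => hy.symm)
  have h4 : ∀ a b, B y₀ (fderiv ℝ Y y₀ a) b + fderiv ℝ B y₀ a (Y y₀) b = 0 := fun a b => by
    have := DFunLike.congr_fun
      (DFunLike.congr_fun (h3.unique (hasFDerivAt_const (0 : E →L[ℝ] ℝ) y₀)) a) b
    simpa using this
  refine h2.congr_deriv ?_
  simp only [add_apply]
  linarith [h4 v w, h4 w v, hcyc (Y y₀) v w, halt v (fderiv ℝ Y y₀ w)]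

end LocalInvariance

/-! ### Invariance of a cosymplectic structure under its Reeb flow -/

section FlowInvariance

variable {E : Type*} [NormedAddCommGroup E] [NormedSpace ℝ E]
  {M : Type*} [TopologicalSpace M] [ChartedSpace E M] {X : M → E} {Φ : ℝ → M → M}

theorem IsCompleteWithFlow.zero_eq (hΦ : IsCompleteWithFlow X Φ) : Φ 0 = fun x => x :=
  funext fun x => (hΦ x).1

/-- The coordinate expression of a flow in the chart at `x₀`. -/
noncomputable def coordFlow (E : Type*) [NormedAddCommGroup E] [NormedSpace ℝ E] {M : Type*}
    [TopologicalSpace M] [ChartedSpace E M] (Φ : ℝ → M → M) (x₀ : M) (p : ℝ × E) : E :=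
  extChartAt 𝓘(ℝ, E) x₀ (Φ p.1 ((extChartAt 𝓘(ℝ, E) x₀).symm p.2))

theorem IsCompleteWithFlow.coordFlow_zero (hΦ : IsCompleteWithFlow X Φ) {x₀ : M} {y : E}
    (hy : y ∈ (extChartAt 𝓘(ℝ, E) x₀).target) : coordFlow E Φ x₀ (0, y) = y := by
  simp only [coordFlow, (hΦ _).1, (extChartAt 𝓘(ℝ, E) x₀).right_inv hy]

theorem IsCompleteWithFlow.zero_mem_source (hΦ : IsCompleteWithFlow X Φ) {x₀ : M} {y : E}
    (hy : y ∈ (extChartAt 𝓘(ℝ, E) x₀).target) :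
    Φ 0 ((extChartAt 𝓘(ℝ, E) x₀).symm y) ∈ (extChartAt 𝓘(ℝ, E) x₀).source := by
  rw [(hΦ _).1]; exact (extChartAt 𝓘(ℝ, E) x₀).map_target hy

theorem IsCompleteWithFlow.eventually_mem_source (hΦ : IsCompleteWithFlow X Φ) (x : M) :
    ∀ᶠ s in 𝓝 (0 : ℝ), Φ s x ∈ (extChartAt 𝓘(ℝ, E) x).source := by
  have h : Tendsto (fun s => Φ s x) (𝓝 0) (𝓝 x) := by
    simpa [(hΦ x).1] using (hΦ x).2.continuous.tendsto 0
  exact h.eventually (extChartAt_source_mem_nhds x)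

variable [FiniteDimensional ℝ E] [IsManifold 𝓘(ℝ, E) ∞ M] [T2Space M]

theorem IsCompleteWithFlow.contMDiff_flow (hΦ : IsCompleteWithFlow X Φ) (hX : IsSmoothField X)
    (t : ℝ) : ContMDiff 𝓘(ℝ, E) 𝓘(ℝ, E) ∞ (Φ t) :=
  (hΦ.contMDiff hX).comp (contMDiff_const.prodMk contMDiff_id)

theorem IsCompleteWithFlow.mdifferentiable_flow (hΦ : IsCompleteWithFlow X Φ)
    (hX : IsSmoothField X) (t : ℝ) : MDifferentiable 𝓘(ℝ, E) 𝓘(ℝ, E) (Φ t) :=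
  (hΦ.contMDiff_flow hX t).mdifferentiable (by simp)

theorem IsCompleteWithFlow.modelDeriv_add (hΦ : IsCompleteWithFlow X Φ) (hX : IsSmoothField X)
    (s t : ℝ) (x : M) :
    modelDeriv E E (Φ (s + t)) x = (modelDeriv E E (Φ s) (Φ t x)).comp (modelDeriv E E (Φ t) x) := by
  rw [← modelDeriv_comp x (hΦ.mdifferentiable_flow hX s _) (hΦ.mdifferentiable_flow hX t _)]
  exact congrArg (fun f => modelDeriv E E f x) (funext (hΦ.add_apply hX s t))

theorem IsCompleteWithFlow.contDiffAt_coordFlow (hΦ : IsCompleteWithFlow X Φ)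
    (hX : IsSmoothField X) {x₀ : M} {s : ℝ} {y : E} (hy : y ∈ (extChartAt 𝓘(ℝ, E) x₀).target)
    (hs : Φ s ((extChartAt 𝓘(ℝ, E) x₀).symm y) ∈ (extChartAt 𝓘(ℝ, E) x₀).source) :
    ContDiffAt ℝ ∞ (coordFlow E Φ x₀) (s, y) := by
  rw [← contMDiffAt_iff_contDiffAt]
  have h1 : ContMDiffAt 𝓘(ℝ, ℝ × E) (𝓘(ℝ, ℝ).prod 𝓘(ℝ, E)) ∞
      (fun p : ℝ × E => (p.1, (extChartAt 𝓘(ℝ, E) x₀).symm p.2)) (s, y) :=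
    contDiffAt_fst.contMDiffAt.prodMk (ContMDiffAt.comp (s, y) (f := Prod.snd)
      (contMDiffAt_extChartAt_symm hy) contDiffAt_snd.contMDiffAt)
  have h2 := ContMDiffAt.comp (s, y) (g := fun p : ℝ × M => Φ p.1 p.2)
    (hΦ.contMDiff hX).contMDiffAt h1
  exact ContMDiffAt.comp (s, y) (g := extChartAt 𝓘(ℝ, E) x₀)
    (contMDiffAt_extChartAt_of_mem_source hs) h2

theorem IsCompleteWithFlow.fderiv_coordFlow_zero (hΦ : IsCompleteWithFlow X Φ)
    (hX : IsSmoothField X) {x₀ : M} {y : E} (hy : y ∈ (extChartAt 𝓘(ℝ, E) x₀).target) :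
    fderiv ℝ (coordFlow E Φ x₀) (0, y) (1, 0) = fieldInChart X x₀ y := by
  have hd := ((hΦ.contDiffAt_coordFlow hX hy (hΦ.zero_mem_source hy)).differentiableAt
    (by simp)).hasFDerivAt.comp_hasDerivAt (0 : ℝ)
    ((hasDerivAt_id (0 : ℝ)).prodMk (hasDerivAt_const (0 : ℝ) y))
  have h2 := hasDerivAt_extChartAt_comp ((hΦ ((extChartAt 𝓘(ℝ, E) x₀).symm y)).2 0)
    (hΦ.zero_mem_source hy)
  have h3 := hd.unique h2
  rwa [(hΦ _).1, (extChartAt 𝓘(ℝ, E) x₀).right_inv hy] at h3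

theorem IsCompleteWithFlow.fderiv_coordFlow (hΦ : IsCompleteWithFlow X Φ)
    (hX : IsSmoothField X) {x₀ : M} {s : ℝ} (hs : Φ s x₀ ∈ (extChartAt 𝓘(ℝ, E) x₀).source) (v : E) :
    fderiv ℝ (coordFlow E Φ x₀) (s, extChartAt 𝓘(ℝ, E) x₀ x₀)
      (0, modelDeriv E E (extChartAt 𝓘(ℝ, E) x₀) x₀ v) =
    modelDeriv E E (extChartAt 𝓘(ℝ, E) x₀) (Φ s x₀) (modelDeriv E E (Φ s) x₀ v) := by
  have hx₀ := mem_extChartAt_source (I := 𝓘(ℝ, E)) x₀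
  have hy := mem_extChartAt_target (I := 𝓘(ℝ, E)) x₀
  have hinv := (extChartAt 𝓘(ℝ, E) x₀).left_inv hx₀
  have hs' : Φ s ((extChartAt 𝓘(ℝ, E) x₀).symm (extChartAt 𝓘(ℝ, E) x₀ x₀)) ∈
      (extChartAt 𝓘(ℝ, E) x₀).source := by rwa [hinv]
  have hd := (((hΦ.contDiffAt_coordFlow hX hy hs').differentiableAt (by simp)).hasFDerivAt.comp _
    (hasFDerivAt_prodMk_right s (extChartAt 𝓘(ℝ, E) x₀ x₀))).fderiv
  have h1 : modelDeriv E E (fun y => coordFlow E Φ x₀ (s, y)) (extChartAt 𝓘(ℝ, E) x₀ x₀) =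
      (modelDeriv E E (extChartAt 𝓘(ℝ, E) x₀) (Φ s x₀)).comp ((modelDeriv E E (Φ s) x₀).comp
        (modelDeriv E E (extChartAt 𝓘(ℝ, E) x₀).symm (extChartAt 𝓘(ℝ, E) x₀ x₀))) := by
    have hsymm := mdifferentiableAt_extChartAt_symm hy
    have hflow := hΦ.mdifferentiable_flow hX s
      ((extChartAt 𝓘(ℝ, E) x₀).symm (extChartAt 𝓘(ℝ, E) x₀ x₀))
    have h2 := modelDeriv_comp (extChartAt 𝓘(ℝ, E) x₀ x₀) hflow hsymm
    have h3 := modelDeriv_comp (extChartAt 𝓘(ℝ, E) x₀ x₀)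
      (g := extChartAt 𝓘(ℝ, E) x₀)
      (f := fun y => Φ s ((extChartAt 𝓘(ℝ, E) x₀).symm y))
      (mdifferentiableAt_extChartAt_of_mem_source hs') (hflow.comp _ hsymm)
    rw [h2, hinv] at h3
    exact h3
  rw [modelDeriv_eq_fderiv] at h1
  have h4 := DFunLike.congr_fun (hd.symm.trans h1) (modelDeriv E E (extChartAt 𝓘(ℝ, E) x₀) x₀ v)
  have h5 := modelDeriv_symm_modelDeriv_extChartAt hx₀ v
  simp only [ContinuousLinearMap.comp_apply, h5] at h4
  exact h4

variable {n : ℕ} {Ω : M → E [⋀^Fin 2]→L[ℝ] ℝ} {η : M → E →L[ℝ] ℝ}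

theorem IsCosymplectic.hasDerivAt_pullback_omega (hM : IsCosymplectic n Ω η)
    (hΦ : IsCompleteWithFlow (reebField Ω η) Φ) (x : M) (v w : E) :
    HasDerivAt (fun s => Ω (Φ s x) ![modelDeriv E E (Φ s) x v, modelDeriv E E (Φ s) x w]) 0 0 := by
  have hX := hM.isSmoothField_reebField
  have hx := mem_extChartAt_source (I := 𝓘(ℝ, E)) x
  have hy := mem_extChartAt_target (I := 𝓘(ℝ, E)) x
  have hnhds := extChartAt_target_mem_nhds (I := 𝓘(ℝ, E)) x
  have h := hasDerivAt_twoForm_of_flow (f := coordFlow E Φ x)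
    (Y := fieldInChart (reebField Ω η) x) (y₀ := extChartAt 𝓘(ℝ, E) x x)
    (((contDiffOn_twoFormInChart hM.smooth_omega x).contDiffAt hnhds).differentiableAt (by simp))
    ((hΦ.contDiffAt_coordFlow hX hy (hΦ.zero_mem_source hy)).of_le (by norm_cast))
    (by filter_upwards [hnhds] with y hy using hΦ.coordFlow_zero hy)
    (by filter_upwards [hnhds] with y hy using hΦ.fderiv_coordFlow_zero hX hy)
    (((hX x).contDiffAt hnhds).differentiableAt (by simp))
    (fun a b => by rw [twoFormInChart_apply, twoFormInChart_apply]; exact alternating_swap (Ω _) _ _)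
    (fderiv_twoFormInChart_cyclic hM.smooth_omega hM.closed_omega hy)
    (by filter_upwards [hnhds] with y hy using
      ContinuousLinearMap.ext fun w => hM.twoFormInChart_reebField hy w)
    (modelDeriv E E (extChartAt 𝓘(ℝ, E) x) x v) (modelDeriv E E (extChartAt 𝓘(ℝ, E) x) x w)
  refine h.congr_of_eventuallyEq ?_
  filter_upwards [hΦ.eventually_mem_source x] with s hs
  rw [hΦ.fderiv_coordFlow hX hs, hΦ.fderiv_coordFlow hX hs, coordFlow,
    (extChartAt 𝓘(ℝ, E) x).left_inv hx, twoFormInChart_extChartAt Ω hs]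

theorem IsCosymplectic.hasDerivAt_pullback_eta (hM : IsCosymplectic n Ω η)
    (hΦ : IsCompleteWithFlow (reebField Ω η) Φ) (x : M) (v : E) :
    HasDerivAt (fun s => η (Φ s x) (modelDeriv E E (Φ s) x v)) 0 0 := by
  have hX := hM.isSmoothField_reebField
  have hx := mem_extChartAt_source (I := 𝓘(ℝ, E)) x
  have hy := mem_extChartAt_target (I := 𝓘(ℝ, E)) x
  have hnhds := extChartAt_target_mem_nhds (I := 𝓘(ℝ, E)) x
  have h := hasDerivAt_oneForm_of_flow (f := coordFlow E Φ x)
    (Y := fieldInChart (reebField Ω η) x) (y₀ := extChartAt 𝓘(ℝ, E) x x)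
    (((contDiffOn_oneFormInChart hM.smooth_eta x).contDiffAt hnhds).differentiableAt (by simp))
    ((hΦ.contDiffAt_coordFlow hX hy (hΦ.zero_mem_source hy)).of_le (by norm_cast))
    (by filter_upwards [hnhds] with y hy using hΦ.coordFlow_zero hy)
    (by filter_upwards [hnhds] with y hy using hΦ.fderiv_coordFlow_zero hX hy)
    (((hX x).contDiffAt hnhds).differentiableAt (by simp))
    (fderiv_oneFormInChart_symm hM.smooth_eta hM.closed_eta hy)
    (by filter_upwards [hnhds] with y hy using hM.oneFormInChart_reebField hy)
    (modelDeriv E E (extChartAt 𝓘(ℝ, E) x) x v)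
  refine h.congr_of_eventuallyEq ?_
  filter_upwards [hΦ.eventually_mem_source x] with s hs
  rw [hΦ.fderiv_coordFlow hX hs, coordFlow,
    (extChartAt 𝓘(ℝ, E) x).left_inv hx, oneFormInChart_extChartAt η hs]

/-- By the group law, a pullback at time `s + t` is the pullback by `Φ s` based at `Φ t x`; the
shifted hypothesis thus asks only for derivatives at time zero. -/
theorem eq_of_forall_hasDerivAt_shift {A : ℝ → ℝ}
    (h : ∀ t, HasDerivAt (fun s => A (s + t)) 0 0) (t : ℝ) : A t = A 0 := by
  have h' : ∀ t, HasDerivAt A 0 t := fun t => by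
    have h1 : HasDerivAt (fun s => A (s + t)) 0 (t - t) := by simpa using h t
    simpa using h1.comp_sub_const t t
  exact is_const_of_deriv_eq_zero (fun t => (h' t).differentiableAt) (fun t => (h' t).deriv) t 0

theorem IsCosymplectic.flow_pullback_omega (hM : IsCosymplectic n Ω η)
    (hΦ : IsCompleteWithFlow (reebField Ω η) Φ) (t : ℝ) (x : M) (v w : E) :
    Ω (Φ t x) ![modelDeriv E E (Φ t) x v, modelDeriv E E (Φ t) x w] = Ω x ![v, w] := by
  have hX := hM.isSmoothField_reebField
  have h := eq_of_forall_hasDerivAt_shift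
    (A := fun s => Ω (Φ s x) ![modelDeriv E E (Φ s) x v, modelDeriv E E (Φ s) x w])
    (fun t => by
      simp only [hΦ.add_apply hX, hΦ.modelDeriv_add hX, ContinuousLinearMap.comp_apply]
      exact hM.hasDerivAt_pullback_omega hΦ _ _ _) t
  simpa only [hΦ.zero_eq, modelDeriv_id, ContinuousLinearMap.id_apply] using h

theorem IsCosymplectic.flow_pullback_eta (hM : IsCosymplectic n Ω η)
    (hΦ : IsCompleteWithFlow (reebField Ω η) Φ) (t : ℝ) (x : M) (v : E) :
    η (Φ t x) (modelDeriv E E (Φ t) x v) = η x v := by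
  have hX := hM.isSmoothField_reebField
  have h := eq_of_forall_hasDerivAt_shift
    (A := fun s => η (Φ s x) (modelDeriv E E (Φ s) x v))
    (fun t => by
      simp only [hΦ.add_apply hX, hΦ.modelDeriv_add hX, ContinuousLinearMap.comp_apply]
      exact hM.hasDerivAt_pullback_eta hΦ _ _) t
  simpa only [hΦ.zero_eq, modelDeriv_id, ContinuousLinearMap.id_apply] using h

end FlowInvariance

/-! ### Local primitives and constancy of functions with vanishing derivative -/

section Primitive

variable {E : Type*} [NormedAddCommGroup E] [NormedSpace ℝ E]
  {M : Type*} [TopologicalSpace M] [ChartedSpace E M]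

theorem modelDeriv_sub {f g : M → ℝ} {x : M} (hf : MDifferentiableAt 𝓘(ℝ, E) 𝓘(ℝ, ℝ) f x)
    (hg : MDifferentiableAt 𝓘(ℝ, E) 𝓘(ℝ, ℝ) g x) :
    modelDeriv E ℝ (fun y => f y - g y) x = modelDeriv E ℝ f x - modelDeriv E ℝ g x :=
  mfderiv_sub hf hg

theorem modelDeriv_sub_const {f : M → ℝ} {x : M} (hf : MDifferentiableAt 𝓘(ℝ, E) 𝓘(ℝ, ℝ) f x)
    (c : ℝ) : modelDeriv E ℝ (fun y => f y - c) x = modelDeriv E ℝ f x := by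
  rw [modelDeriv_sub hf mdifferentiableAt_const, modelDeriv_const, sub_zero]

variable [IsManifold 𝓘(ℝ, E) ∞ M]

/-- `W` is a chart ball, chosen before `f`: it will serve a whole family of functions indexed by
`g`. -/
theorem exists_nhds_forall_eq_of_modelDeriv_eq_zero (x : M) {V : Set M} (hV : V ∈ 𝓝 x) :
    ∃ W ∈ 𝓝 x, W ⊆ V ∧ ∀ f : M → ℝ,
      (∀ p ∈ W, MDifferentiableAt 𝓘(ℝ, E) 𝓘(ℝ, ℝ) f p ∧ modelDeriv E ℝ f p = 0) →
        ∀ p ∈ W, f p = f x := by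
  have hx := mem_extChartAt_source (I := 𝓘(ℝ, E)) x
  have hT : (extChartAt 𝓘(ℝ, E) x).target ∩ (extChartAt 𝓘(ℝ, E) x).symm ⁻¹' V ∈
      𝓝 (extChartAt 𝓘(ℝ, E) x x) :=
    inter_mem (extChartAt_target_mem_nhds x)
      ((continuousAt_extChartAt_symm x).preimage_mem_nhds (by simpa using hV))
  obtain ⟨r, hr, hsub⟩ := Metric.mem_nhds_iff.1 hT
  refine ⟨(extChartAt 𝓘(ℝ, E) x).source ∩
    extChartAt 𝓘(ℝ, E) x ⁻¹' Metric.ball (extChartAt 𝓘(ℝ, E) x x) r,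
    inter_mem (extChartAt_source_mem_nhds x)
      ((continuousAt_extChartAt x).preimage_mem_nhds (Metric.ball_mem_nhds _ hr)), ?_, ?_⟩
  · rintro p ⟨hp, hpb⟩
    have := (hsub hpb).2
    rwa [mem_preimage, (extChartAt 𝓘(ℝ, E) x).left_inv hp] at this
  · rintro f hf p ⟨hp, hpb⟩
    have key : ∀ y ∈ Metric.ball (extChartAt 𝓘(ℝ, E) x x) r,
        MDifferentiableAt 𝓘(ℝ, E) 𝓘(ℝ, ℝ) (fun y => f ((extChartAt 𝓘(ℝ, E) x).symm y)) y ∧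
          modelDeriv E ℝ (fun y => f ((extChartAt 𝓘(ℝ, E) x).symm y)) y = 0 := by
      intro y hy
      have hyt := (hsub hy).1
      obtain ⟨h1, h2⟩ := hf ((extChartAt 𝓘(ℝ, E) x).symm y)
        ⟨(extChartAt 𝓘(ℝ, E) x).map_target hyt, by
          rwa [mem_preimage, (extChartAt 𝓘(ℝ, E) x).right_inv hyt]⟩
      have h3 := mdifferentiableAt_extChartAt_symm hyt
      exact ⟨h1.comp y h3, by rw [modelDeriv_comp y h1 h3, h2, ContinuousLinearMap.zero_comp]⟩
    have h := Metric.isOpen_ball.is_const_of_fderiv_eq_zero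
      (convex_ball (extChartAt 𝓘(ℝ, E) x x) r).isPreconnected
      (fun y hy => (mdifferentiableAt_iff_differentiableAt.1 (key y hy).1).differentiableWithinAt)
      (fun y hy => by rw [← modelDeriv_eq_fderiv]; exact (key y hy).2) hpb (Metric.mem_ball_self hr)
    simpa only [(extChartAt 𝓘(ℝ, E) x).left_inv hp, (extChartAt 𝓘(ℝ, E) x).left_inv hx] using h

theorem eq_of_modelDeriv_eq_zero [PreconnectedSpace M] {f : M → ℝ}
    (hf : MDifferentiable 𝓘(ℝ, E) 𝓘(ℝ, ℝ) f) (hf' : ∀ x, modelDeriv E ℝ f x = 0) (x y : M) :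
    f x = f y := by
  have h : IsLocallyConstant f := (IsLocallyConstant.iff_eventually_eq f).2 fun x => by
    obtain ⟨W, hW, -, h⟩ := exists_nhds_forall_eq_of_modelDeriv_eq_zero (E := E) x univ_mem
    filter_upwards [hW] with p hp using h f (fun p _ => ⟨hf p, hf' p⟩) p hp
  exact h.apply_eq_of_preconnectedSpace x y

/-- The Poincaré lemma on a convex ball in the chart. -/
theorem exists_local_primitive {η : M → E →L[ℝ] ℝ} (hη : IsSmoothForm (oneForm η))
    (hcl : IsClosedForm (oneForm η)) (x : M) :
    ∃ U ∈ 𝓝 x, ∃ H : M → ℝ, ∀ p ∈ U,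
      MDifferentiableAt 𝓘(ℝ, E) 𝓘(ℝ, ℝ) H p ∧ modelDeriv E ℝ H p = η p := by
  obtain ⟨r, hr, hsub⟩ := Metric.mem_nhds_iff.1 (extChartAt_target_mem_nhds (I := 𝓘(ℝ, E)) x)
  obtain ⟨h, hh⟩ := Convex.exists_forall_hasFDerivAt_of_fderiv_symmetric
    (convex_ball (extChartAt 𝓘(ℝ, E) x x) r) Metric.isOpen_ball
    (((contDiffOn_oneFormInChart hη x).mono hsub).differentiableOn (by simp))
    (fun y hy v w => fderiv_oneFormInChart_symm hη hcl (hsub hy) v w)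
  refine ⟨(extChartAt 𝓘(ℝ, E) x).source ∩
    extChartAt 𝓘(ℝ, E) x ⁻¹' Metric.ball (extChartAt 𝓘(ℝ, E) x x) r,
    inter_mem (extChartAt_source_mem_nhds x)
      ((continuousAt_extChartAt x).preimage_mem_nhds (Metric.ball_mem_nhds _ hr)),
    fun p => h (extChartAt 𝓘(ℝ, E) x p), ?_⟩
  rintro p ⟨hp, hpb⟩
  have h1 := (hh _ hpb).differentiableAt.mdifferentiableAt
  have h2 := mdifferentiableAt_extChartAt_of_mem_source hp
  refine ⟨h1.comp p h2, ?_⟩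
  rw [modelDeriv_comp p h1 h2, modelDeriv_eq_fderiv, (hh _ hpb).fderiv]
  exact ContinuousLinearMap.ext fun v => oneFormInChart_extChartAt η hp v

end Primitive

/-! ### The value of a closed form on infinitesimal generators -/

section Generator

variable {E : Type*} [NormedAddCommGroup E] [NormedSpace ℝ E]
  {M : Type*} [TopologicalSpace M] [ChartedSpace E M]
  {F : Type*} [NormedAddCommGroup F] [NormedSpace ℝ F]
  {G : Type*} [TopologicalSpace G] [ChartedSpace F G] [Group G] {φ : G → M → M}

theorem IsSmoothAction.contMDiff_act (hφ : IsSmoothAction (E := E) (F := F) φ) (g : G) :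
    ContMDiff 𝓘(ℝ, E) 𝓘(ℝ, E) ∞ (φ g) :=
  hφ.smooth.comp (contMDiff_const.prodMk contMDiff_id)

theorem IsSmoothAction.mdifferentiable_act (hφ : IsSmoothAction (E := E) (F := F) φ) (g : G) :
    MDifferentiable 𝓘(ℝ, E) 𝓘(ℝ, E) (φ g) :=
  (hφ.contMDiff_act g).mdifferentiable (by simp)

theorem IsSmoothAction.mdifferentiable_orbit (hφ : IsSmoothAction (E := E) (F := F) φ) (x : M) :
    MDifferentiable 𝓘(ℝ, F) 𝓘(ℝ, E) (fun g => φ g x) :=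
  (hφ.smooth.comp (contMDiff_id.prodMk contMDiff_const)).mdifferentiable (by simp)

theorem IsSmoothAction.modelDeriv_comp_orbit (hφ : IsSmoothAction (E := E) (F := F) φ) {p : M}
    {H : M → ℝ} (hH : MDifferentiableAt 𝓘(ℝ, E) 𝓘(ℝ, ℝ) H p) :
    MDifferentiableAt 𝓘(ℝ, F) 𝓘(ℝ, ℝ) (fun g => H (φ g p)) 1 ∧
      modelDeriv F ℝ (fun g => H (φ g p)) 1 =
        (modelDeriv E ℝ H p).comp (modelDeriv F E (fun g => φ g p) 1) := by
  have h1 : MDifferentiableAt 𝓘(ℝ, E) 𝓘(ℝ, ℝ) H (φ 1 p) := by rwa [hφ.one_act]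
  have h2 := hφ.mdifferentiable_orbit p 1
  refine ⟨h1.comp (1 : G) (f := fun g => φ g p) h2, ?_⟩
  have h3 := modelDeriv_comp (1 : G) (f := fun g => φ g p) h1 h2
  rwa [hφ.one_act] at h3

/-- With `dH = η`, the function `q ↦ H (φ g q) - H q` has derivative `φ_g^* η - η = 0`. Hence the
orbit functions `g ↦ H (φ g p)` and `g ↦ H (φ g x)` differ by a constant near `1`, and their
derivatives there are the two sides. -/
theorem eventually_oneForm_generator_eq [IsManifold 𝓘(ℝ, E) ∞ M] {η : M → E →L[ℝ] ℝ}
    (hη : IsSmoothForm (oneForm η)) (hcl : IsClosedForm (oneForm η))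
    (hφ : IsSmoothAction (E := E) (F := F) φ)
    (hinv : ∀ g x, (η (φ g x)).comp (modelDeriv E E (φ g) x) = η x) (x : M) :
    ∀ᶠ p in 𝓝 x, (η p).comp (modelDeriv F E (fun g => φ g p) 1) =
      (η x).comp (modelDeriv F E (fun g => φ g x) 1) := by
  obtain ⟨U, hU, H, hH⟩ := exists_local_primitive hη hcl x
  have hmem : (fun q : G × M => φ q.1 q.2) ⁻¹' U ∈ 𝓝 ((1 : G), x) :=
    hφ.smooth.continuous.continuousAt.preimage_mem_nhds (by simpa only [hφ.one_act] using hU)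
  -- A product neighborhood is needed so that one set of points `V` works for all `g` in `N`.
  obtain ⟨N, hN, V, hV, hNV⟩ := mem_nhds_prod_iff.1 hmem
  obtain ⟨W, hW, hWV, hconst⟩ :=
    exists_nhds_forall_eq_of_modelDeriv_eq_zero (E := E) x (inter_mem hV hU)
  filter_upwards [hW] with p hp
  have hxU := mem_of_mem_nhds hU
  have key : (fun g => H (φ g p)) =ᶠ[𝓝 1] fun g => H (φ g x) - (H x - H p) := by
    filter_upwards [hN] with g hg
    have := hconst (fun q => H (φ g q) - H q) (fun q hq => by
      obtain ⟨h1, h2⟩ := hH (φ g q) (hNV (mk_mem_prod hg (hWV hq).1))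
      obtain ⟨h3, h4⟩ := hH q (hWV hq).2
      have h5 := hφ.mdifferentiable_act g q
      have h6 : MDifferentiableAt 𝓘(ℝ, E) 𝓘(ℝ, ℝ) (fun q => H (φ g q)) q := h1.comp q h5
      refine ⟨h6.sub h3, ?_⟩
      rw [modelDeriv_sub h6 h3, h4]
      have h7 := modelDeriv_comp q h1 h5
      rw [h2, hinv] at h7
      exact sub_eq_zero.2 h7) p hp
    linarith
  have h1 := hφ.modelDeriv_comp_orbit (hH p (hWV hp).2).1
  have h2 := hφ.modelDeriv_comp_orbit (hH x hxU).1
  rw [← (hH p (hWV hp).2).2, ← (hH x hxU).2, ← h1.2, ← h2.2, modelDeriv_congr key,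
    modelDeriv_sub_const h2.1]

theorem oneForm_generator_eq_etaCocycle [IsManifold 𝓘(ℝ, E) ∞ M] [ConnectedSpace M]
    {η : M → E →L[ℝ] ℝ} (hη : IsSmoothForm (oneForm η)) (hcl : IsClosedForm (oneForm η))
    (hφ : IsSmoothAction (E := E) (F := F) φ)
    (hinv : ∀ g x, (η (φ g x)).comp (modelDeriv E E (φ g) x) = η x) (x : M) :
    (η x).comp (modelDeriv F E (fun g => φ g x) 1) = etaCocycle (F := F) η φ :=
  IsLocallyConstant.apply_eq_of_preconnectedSpace
    (f := fun x => (η x).comp (modelDeriv F E (fun g => φ g x) 1))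
    ((IsLocallyConstant.iff_eventually_eq _).2
      (eventually_oneForm_generator_eq hη hcl hφ hinv)) x (Classical.arbitrary M)

end Generator

/-! ### Multiplicative primitives of left-invariant forms -/

section Multiplicative

variable {F : Type*} [NormedAddCommGroup F] [NormedSpace ℝ F]
  {G : Type*} [TopologicalSpace G] [ChartedSpace F G] [Group G]

theorem leftInvariantForm_one (c : F →L[ℝ] ℝ) : leftInvariantForm (F := F) c (1 : G) = c := by
  have e : (fun h : G => (1 : G)⁻¹ * h) = fun h => h := by ext h; simp
  have h : c.comp (modelDeriv F F (fun h : G => (1 : G)⁻¹ * h) 1) = c := by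
    rw [e, modelDeriv_id]; rfl
  exact h

theorem IsMultiplicativePrimitive.map_one {β : G → F →L[ℝ] ℝ} {f : G → ℝ}
    (hf : IsMultiplicativePrimitive β f) : f 1 = 0 := by
  simpa using hf.map_mul 1 1

theorem IsMultiplicativePrimitive.map_inv {β : G → F →L[ℝ] ℝ} {f : G → ℝ}
    (hf : IsMultiplicativePrimitive β f) (g : G) : f g⁻¹ = -f g := by
  have := hf.map_mul g⁻¹ g
  rw [inv_mul_cancel, hf.map_one] at this
  linarith

theorem IsMultiplicativePrimitive.modelDeriv_eq {β : G → F →L[ℝ] ℝ} {f : G → ℝ}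
    (hf : IsMultiplicativePrimitive β f) (g : G) : modelDeriv F ℝ f g = β g :=
  ContinuousLinearMap.ext (hf.deriv_eq g)

variable [LieGroup 𝓘(ℝ, F) ∞ G]

/-- Left invariance, from `(g k)⁻¹ (g h) = k⁻¹ h` and the chain rule. -/
theorem modelDeriv_mul_left_comp (c : F →L[ℝ] ℝ) (g k : G) :
    (leftInvariantForm (F := F) c (g * k) : F →L[ℝ] ℝ).comp (modelDeriv F F (fun h : G => g * h) k) =
      leftInvariantForm (F := F) c k := by
  have hl : ∀ a : G, MDifferentiable 𝓘(ℝ, F) 𝓘(ℝ, F) (fun h : G => a * h) := fun a =>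
    (contMDiff_mul_left (I := 𝓘(ℝ, F)) (n := ∞) (a := a)).mdifferentiable (by simp)
  have h := modelDeriv_comp k (hl (g * k)⁻¹ (g * k)) (hl g k)
  have e : (fun h : G => (g * k)⁻¹ * (g * h)) = fun h => k⁻¹ * h := by ext h; group
  rw [e] at h
  exact (congrArg c.comp h).symm

/-- Multiplicativity forces `f 1 = 0`, which fixes the additive constant. By left invariance `k ↦ h
(g k) - h k` has zero derivative; comparing `k` with `1` gives the product rule. -/
theorem IsExactOneForm.existsUnique_isMultiplicativePrimitive [ConnectedSpace G] {c : F →L[ℝ] ℝ}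
    (h : IsExactOneForm (leftInvariantForm (F := F) (G := G) c)) :
    ∃! f : G → ℝ, IsMultiplicativePrimitive (leftInvariantForm (F := F) c) f := by
  obtain ⟨h, hs, hd⟩ := h
  have hd' : ∀ g, modelDeriv F ℝ h g = leftInvariantForm (F := F) c g := fun g =>
    ContinuousLinearMap.ext (hd g)
  have hm : MDifferentiable 𝓘(ℝ, F) 𝓘(ℝ, ℝ) h := hs.mdifferentiable (by simp)
  have hf : IsMultiplicativePrimitive (leftInvariantForm (F := F) c) fun g => h g - h 1 := by
    refine ⟨hs.sub contMDiff_const, fun g k => ?_, fun g v =>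
      (DFunLike.congr_fun (modelDeriv_sub_const (hm g) (h 1)) v).trans (hd g v)⟩
    have hl : MDifferentiable 𝓘(ℝ, F) 𝓘(ℝ, F) (fun k : G => g * k) :=
      (contMDiff_mul_left (I := 𝓘(ℝ, F)) (n := ∞) (a := g)).mdifferentiable (by simp)
    have hc : MDifferentiable 𝓘(ℝ, F) 𝓘(ℝ, ℝ) fun k => h (g * k) := hm.comp hl
    have := eq_of_modelDeriv_eq_zero (E := F) (f := fun k => h (g * k) - h k)
      (hc.sub hm) (fun k => by
        rw [modelDeriv_sub (hc k) (hm k)]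
        have h1 := modelDeriv_comp k (hm (g * k)) (hl k)
        have h2 := congrArg (fun A => A.comp (modelDeriv F F (fun h : G => g * h) k)) (hd' (g * k))
        exact sub_eq_zero.2 (h1.trans (h2.trans ((modelDeriv_mul_left_comp c g k).trans
          (hd' k).symm)))) k 1
    rw [mul_one] at this
    linarith
  refine ⟨_, hf, fun f' hf' => funext fun g => ?_⟩
  have hm' : MDifferentiable 𝓘(ℝ, F) 𝓘(ℝ, ℝ) f' := hf'.smooth.mdifferentiable (by simp)
  have := eq_of_modelDeriv_eq_zero (E := F) (f := fun k => f' k - h k) (hm'.sub hm) (fun k => by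
    rw [modelDeriv_sub (hm' k) (hm k), hf'.modelDeriv_eq, hd']
    exact sub_self _) g 1
  rw [hf'.map_one] at this
  linarith

end Multiplicative

/-! ### The modified action -/

section FlowDerivative

variable {E : Type*} [NormedAddCommGroup E] [NormedSpace ℝ E]

theorem alternating_sub_smul (A : E [⋀^Fin 2]→L[ℝ] ℝ) {R v : E} (hR : A ![R, v] = 0) (u : E)
    (r : ℝ) : A ![u - r • R, v] = A ![u, v] := by
  simp only [← formPairing_apply] at hR ⊢
  rw [map_sub, map_smul, sub_apply, smul_apply, hR, smul_zero, sub_zero]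

variable {M : Type*} [TopologicalSpace M] [ChartedSpace E M]
  {F : Type*} [NormedAddCommGroup F] [NormedSpace ℝ F]
  {N : Type*} [TopologicalSpace N] [ChartedSpace F N]

/-- The derivative of `g ↦ Φ_{a(g)}(b(g))` at a point where `a` vanishes. -/
theorem IsCompleteWithFlow.modelDeriv_flow_apply [FiniteDimensional ℝ E] [IsManifold 𝓘(ℝ, E) ∞ M]
    [T2Space M] {Φ : ℝ → M → M} {X : M → E} (hΦ : IsCompleteWithFlow X Φ) (hX : IsSmoothField X)
    {a : N → ℝ}
    {b : N → M} {g : N} (ha : MDifferentiableAt 𝓘(ℝ, F) 𝓘(ℝ, ℝ) a g)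
    (hb : MDifferentiableAt 𝓘(ℝ, F) 𝓘(ℝ, E) b g) (h0 : a g = 0) (ξ : F) :
    modelDeriv F E (fun k => Φ (a k) (b k)) g ξ =
      modelDeriv F ℝ a g ξ • X (b g) + modelDeriv F E b g ξ := by
  have hd : MDifferentiableAt (𝓘(ℝ, ℝ).prod 𝓘(ℝ, E)) 𝓘(ℝ, E) (fun p : ℝ × M => Φ p.1 p.2)
      (a g, b g) := (hΦ.contMDiff hX).mdifferentiable (by simp) _
  have h1 : modelDeriv F E (fun k => Φ (a k) (b k)) g ξ =
      mfderiv (𝓘(ℝ, ℝ).prod 𝓘(ℝ, E)) 𝓘(ℝ, E) (fun p : ℝ × M => Φ p.1 p.2) (a g, b g)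
        (modelDeriv F ℝ a g ξ, modelDeriv F E b g ξ) := by
    have h2 := mfderiv_comp g (f := fun k => (a k, b k)) hd (ha.prodMk hb)
    rw [mfderiv_prodMk ha hb] at h2
    exact DFunLike.congr_fun h2 ξ
  rw [h1]
  refine (mfderiv_prod_eq_add_apply hd).trans ?_
  have h3 : modelDeriv ℝ E (fun t => Φ t (b g)) (a g) (modelDeriv F ℝ a g ξ) =
      modelDeriv F ℝ a g ξ • X (b g) := by
    have h4 : modelDeriv ℝ E (fun t => Φ t (b g)) 0 =
        (1 : ℝ →L[ℝ] ℝ).smulRight (X (Φ 0 (b g))) := ((hΦ (b g)).2 0).mfderiv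
    rw [h0, h4, (hΦ (b g)).1]
    rfl
  have h5 : modelDeriv E E (fun p => Φ (a g) p) (b g) (modelDeriv F E b g ξ) =
      modelDeriv F E b g ξ := by
    rw [h0, hΦ.zero_eq, modelDeriv_id]; rfl
  exact congrArg₂ (· + ·) h3 h5

end FlowDerivative

section ModifiedAction

variable {E : Type*} [NormedAddCommGroup E] [NormedSpace ℝ E]
  {M : Type*} [TopologicalSpace M] [ChartedSpace E M]
  {F : Type*} [NormedAddCommGroup F] [NormedSpace ℝ F]
  {G : Type*} [TopologicalSpace G] [ChartedSpace F G] [Group G] {φ : G → M → M}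
  {n : ℕ} {Ω : M → E [⋀^Fin 2]→L[ℝ] ℝ} {η : M → E →L[ℝ] ℝ}

theorem IsCosymplecticAction.omega_apply (hφ : IsCosymplecticAction (F := F) Ω η φ) (g : G) (x : M)
    (v w : E) : Ω (φ g x) ![modelDeriv E E (φ g) x v, modelDeriv E E (φ g) x w] = Ω x ![v, w] := by
  have h := DFunLike.congr_fun (hφ.pullback_omega g x) ![v, w]
  refine Eq.trans (congrArg (Ω (φ g x)) (funext fun i => ?_)) h
  fin_cases i <;> rfl

theorem IsCosymplecticAction.eta_comp (hφ : IsCosymplecticAction (F := F) Ω η φ) (g : G) (x : M) :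
    (η (φ g x)).comp (modelDeriv E E (φ g) x) = η x :=
  hφ.pullback_eta g x

theorem IsCosymplecticAction.eta_apply (hφ : IsCosymplecticAction (F := F) Ω η φ) (g : G) (x : M)
    (v : E) : η (φ g x) (modelDeriv E E (φ g) x v) = η x v :=
  DFunLike.congr_fun (hφ.eta_comp g x) v

/-- The image of `R` satisfies the two equations characterizing `R` at the image point. Testing
against an arbitrary `w` uses that `w` is the image of a vector under the invertible derivative of
`φ g`. -/
theorem IsCosymplecticAction.modelDeriv_reebField (hM : IsCosymplectic n Ω η)
    (hφ : IsCosymplecticAction (F := F) Ω η φ) (g : G) (x : M) :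
    modelDeriv E E (φ g) x (reebField Ω η x) = reebField Ω η (φ g x) := by
  refine hM.eq_reebField _ (fun w => ?_) ?_
  · have hA := hφ.isSmoothAction
    have hinv : (fun y => φ g (φ g⁻¹ y)) = fun y => y := by
      ext y; rw [← hA.mul_act, mul_inv_cancel, hA.one_act]
    have hx : φ g⁻¹ (φ g x) = x := by rw [← hA.mul_act, inv_mul_cancel, hA.one_act]
    have h := modelDeriv_comp (φ g x) (hA.mdifferentiable_act g _) (hA.mdifferentiable_act g⁻¹ _)
    rw [hinv, modelDeriv_id, hx] at h
    have hw : modelDeriv E E (φ g) x (modelDeriv E E (φ g⁻¹) (φ g x) w) = w :=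
      (DFunLike.congr_fun h w).symm
    have h1 := hφ.omega_apply g x (reebField Ω η x) (modelDeriv E E (φ g⁻¹) (φ g x) w)
    rw [hw] at h1
    exact h1.trans ((hM.reebField_spec x).1 _)
  · exact (hφ.eta_apply g x _).trans (hM.reebField_spec x).2

variable {Φ : ℝ → M → M}

/-- `φ g` carries integral curves of `R` to integral curves of `R`, and these are unique. -/
theorem IsCosymplecticAction.act_flow [FiniteDimensional ℝ E] [IsManifold 𝓘(ℝ, E) ∞ M] [T2Space M]
    (hM : IsCosymplectic n Ω η) (hφ : IsCosymplecticAction (F := F) Ω η φ)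
    (hΦ : IsCompleteWithFlow (reebField Ω η) Φ) (g : G) (t : ℝ) (x : M) :
    φ g (Φ t x) = Φ t (φ g x) := by
  have h : IsMIntegralCurve (I := 𝓘(ℝ, E)) (fun t => φ g (Φ t x)) (reebField Ω η) := fun t => by
    have h1 := (hφ.isSmoothAction.mdifferentiable_act g (Φ t x)).hasMFDerivAt.comp t ((hΦ x).2 t)
    refine h1.congr_mfderiv (ContinuousLinearMap.ext fun r : ℝ => ?_)
    have h2 : modelDeriv E E (φ g) (Φ t x) (r • reebField Ω η (Φ t x)) =
        r • reebField Ω η (φ g (Φ t x)) :=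
      (map_smul (modelDeriv E E (φ g) (Φ t x)) r _).trans
        (congrArg (fun u : E => r • u) (hφ.modelDeriv_reebField hM g (Φ t x)))
    exact h2
  have h2 := hΦ.eq_of_isMIntegralCurve hM.isSmoothField_reebField h t
  rwa [(hΦ x).1] at h2

/-- Along the flow, `dJ_ξ(R) = Ω(ξ_M, R) = 0`. -/
theorem IsMomentumMap.apply_flow_eq [FiniteDimensional ℝ E] [IsManifold 𝓘(ℝ, E) ∞ M] [T2Space M]
    {J : M → F →L[ℝ] ℝ} (hM : IsCosymplectic n Ω η) (hJ : IsMomentumMap (F := F) Ω φ J)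
    (hΦ : IsCompleteWithFlow (reebField Ω η) Φ) (t : ℝ) (x : M) : J (Φ t x) = J x := by
  refine ContinuousLinearMap.ext fun ξ => ?_
  have hm : MDifferentiable 𝓘(ℝ, E) 𝓘(ℝ, ℝ) fun y => J y ξ :=
    (hJ.smooth.clm_apply contMDiff_const).mdifferentiable (by simp)
  have hd : ∀ s, HasDerivAt (fun s => J (Φ s x) ξ) 0 s := fun s => by
    have h1 := (hm (Φ s x)).hasMFDerivAt.comp s ((hΦ x).2 s)
    refine hasMFDerivAt_iff_hasFDerivAt.1 (h1.congr_mfderiv ?_)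
    have h2 := hJ.contraction_eq ξ (Φ s x) (reebField Ω η (Φ s x))
    have h3 : Ω (Φ s x) ![infinitesimalGenerator φ (Φ s x) ξ, reebField Ω η (Φ s x)] = 0 :=
      (alternating_swap (Ω (Φ s x)) _ _).trans (neg_eq_zero.2 ((hM.reebField_spec _).1 _))
    have h4 : modelDeriv E ℝ (fun y => J y ξ) (Φ s x) (reebField Ω η (Φ s x)) = 0 :=
      h2.symm.trans h3
    refine ContinuousLinearMap.ext fun r : ℝ => ?_
    have h5 : modelDeriv E ℝ (fun y => J y ξ) (Φ s x) (r • reebField Ω η (Φ s x)) = r • (0 : ℝ) :=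
      (map_smul (modelDeriv E ℝ (fun y => J y ξ) (Φ s x)) r _).trans
        (congrArg (fun u : ℝ => r • u) h4)
    exact h5
  have h := is_const_of_deriv_eq_zero (fun s => (hd s).differentiableAt) (fun s => (hd s).deriv) t 0
  simpa only [(hΦ x).1] using h

variable [FiniteDimensional ℝ E] [IsManifold 𝓘(ℝ, E) ∞ M] [T2Space M] {β : G → F →L[ℝ] ℝ}
  {f : G → ℝ}

theorem IsCosymplecticAction.modifiedAction (hM : IsCosymplectic n Ω η)
    (hφ : IsCosymplecticAction (F := F) Ω η φ) (hΦ : IsCompleteWithFlow (reebField Ω η) Φ)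
    (hf : IsMultiplicativePrimitive β f) :
    IsCosymplecticAction (F := F) Ω η (modifiedAction Φ f φ) := by
  have hX := hM.isSmoothField_reebField
  have hA := hφ.isSmoothAction
  have hc : ∀ g x, modelDeriv E E (_root_.modifiedAction Φ f φ g) x =
      (modelDeriv E E (Φ (f g⁻¹)) (φ g x)).comp (modelDeriv E E (φ g) x) := fun g x =>
    modelDeriv_comp x (hΦ.mdifferentiable_flow hX _ _) (hA.mdifferentiable_act g x)
  refine ⟨⟨fun x => ?_, fun g h x => ?_, ?_⟩, fun g x => ?_, fun g x => ?_⟩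
  · rw [_root_.modifiedAction, inv_one, hf.map_one, (hΦ _).1, hA.one_act]
  · simp only [_root_.modifiedAction]
    -- The reversed order in `(g h)⁻¹` is harmless since `ℝ` is commutative; `act_flow` then moves
    -- `φ g` past the flow.
    rw [mul_inv_rev, hf.map_mul, add_comm, hA.mul_act, hφ.act_flow hM hΦ, hΦ.add_apply hX]
  · have h1 : ContMDiff (𝓘(ℝ, F).prod 𝓘(ℝ, E)) 𝓘(ℝ, ℝ) ∞ fun p : G × M => f p.1⁻¹ := by
      have : (fun p : G × M => f p.1⁻¹) = fun p => -f p.1 := funext fun p => hf.map_inv p.1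
      rw [this]
      exact (hf.smooth.comp contMDiff_fst).neg
    exact (hΦ.contMDiff hX).comp (h1.prodMk hA.smooth)
  · refine ContinuousAlternatingMap.ext fun v : Fin 2 → E => ?_
    have h1 : ![v 0, v 1] = v := by ext i; fin_cases i <;> rfl
    have h2 : Ω (_root_.modifiedAction Φ f φ g x)
        ![modelDeriv E E (_root_.modifiedAction Φ f φ g) x (v 0),
          modelDeriv E E (_root_.modifiedAction Φ f φ g) x (v 1)] = Ω x ![v 0, v 1] := by
      rw [hc, ← hφ.omega_apply g x]
      exact hM.flow_pullback_omega hΦ _ _ _ _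
    rw [h1] at h2
    refine Eq.trans (congrArg (Ω _) (funext fun i => ?_)) h2
    fin_cases i <;> rfl
  · refine ContinuousLinearMap.ext fun v : E => ?_
    have h2 : η (_root_.modifiedAction Φ f φ g x)
        (modelDeriv E E (_root_.modifiedAction Φ f φ g) x v) = η x v := by
      rw [hc, ← hφ.eta_apply g x]
      exact hM.flow_pullback_eta hΦ _ _ _
    exact h2

/-- At `g = 1` the flow time `f g⁻¹ = -f g` vanishes, so the product rule contributes the orbit
derivative and `-df(ξ) X`. -/
theorem modelDeriv_modifiedAction_orbit {X : M → E} (hA : IsSmoothAction (E := E) (F := F) φ)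
    (hΦ : IsCompleteWithFlow X Φ) (hX : IsSmoothField X) (hf : IsMultiplicativePrimitive β f)
    (ξ : F) (x : M) :
    modelDeriv F E (fun g => modifiedAction Φ f φ g x) 1 ξ =
      modelDeriv F E (fun g => φ g x) 1 ξ - β 1 ξ • X x := by
  have hm : MDifferentiable 𝓘(ℝ, F) 𝓘(ℝ, ℝ) f := hf.smooth.mdifferentiable (by simp)
  have hinv : (fun g => f g⁻¹) = fun g => -f g := funext hf.map_inv
  have hm' : MDifferentiableAt 𝓘(ℝ, F) 𝓘(ℝ, ℝ) (fun g => f g⁻¹) 1 := by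
    rw [hinv]; exact (hm 1).neg
  have hd : modelDeriv F ℝ (fun g => f g⁻¹) 1 = -β 1 := by
    rw [hinv, ← hf.modelDeriv_eq]; exact mfderiv_neg
  have h := hΦ.modelDeriv_flow_apply hX hm' (hA.mdifferentiable_orbit x 1)
    (by rw [inv_one, hf.map_one]) ξ
  rw [hd, hA.one_act] at h
  refine h.trans ?_
  rw [neg_apply, neg_smul, neg_add_eq_sub]

end ModifiedAction

theorem mainTheorem4
    {E : Type*} [NormedAddCommGroup E] [NormedSpace ℝ E] [FiniteDimensional ℝ E]
    {M : Type*} [TopologicalSpace M] [ChartedSpace E M] [IsManifold 𝓘(ℝ, E) ∞ M]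
    [T2Space M] [ConnectedSpace M]
    {F : Type*} [NormedAddCommGroup F] [NormedSpace ℝ F] [FiniteDimensional ℝ F]
    {G : Type*} [TopologicalSpace G] [ChartedSpace F G] [Group G] [LieGroup 𝓘(ℝ, F) ∞ G]
    (n : ℕ)
    (Ω : ∀ x : M, TangentSpace 𝓘(ℝ, E) x [⋀^Fin 2]→L[ℝ] ℝ)
    (η : ∀ x : M, TangentSpace 𝓘(ℝ, E) x →L[ℝ] ℝ)
    (hM : IsCosymplectic n Ω η)
    (φ : G → M → M) (J : M → GroupLieAlgebra 𝓘(ℝ, F) G →L[ℝ] ℝ)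
    (hφ : IsEquivariantHamiltonianAction Ω η φ J)
    (Φ : ℝ → M → M) (hΦ : IsCompleteWithFlow (reebField Ω η) Φ)
    (hexact : IsExactOneForm (leftInvariantForm (etaCocycle (F := F) η φ))) :
    (∀ (ξ : GroupLieAlgebra 𝓘(ℝ, F) G) (x : M),
      η x (infinitesimalGenerator φ x ξ) = etaCocycle η φ ξ) ∧
    (ConnectedSpace G →
      ∃! f : G → ℝ, IsMultiplicativePrimitive (leftInvariantForm (etaCocycle (F := F) η φ)) f) ∧
    ∀ f : G → ℝ, IsMultiplicativePrimitive (leftInvariantForm (etaCocycle (F := F) η φ)) f →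
      IsEquivariantHamiltonianAction Ω η (modifiedAction Φ f φ) J ∧
      ∀ (ξ : GroupLieAlgebra 𝓘(ℝ, F) G) (x : M),
        η x (infinitesimalGenerator (modifiedAction Φ f φ) x ξ) = 0 := by
  have hC := hφ.isCosymplecticAction
  have hA := hC.isSmoothAction
  have hX := hM.isSmoothField_reebField
  have hc : ∀ x : M, (η x).comp (infinitesimalGenerator φ x) = etaCocycle (F := F) η φ :=
    oneForm_generator_eq_etaCocycle (E := E) (F := F) hM.smooth_eta hM.closed_eta hA hC.eta_comp
  have hgen : ∀ (ξ : GroupLieAlgebra 𝓘(ℝ, F) G) (x : M),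
      η x (infinitesimalGenerator φ x ξ) = etaCocycle η φ ξ := fun ξ x =>
    DFunLike.congr_fun (hc x) ξ
  refine ⟨hgen, fun _ => hexact.existsUnique_isMultiplicativePrimitive, fun f hf => ?_⟩
  have hgen' := fun (ξ : F) (x : M) =>
    modelDeriv_modifiedAction_orbit (F := F) (X := reebField Ω η) hA hΦ hX hf ξ x
  refine ⟨⟨hC.modifiedAction hM hΦ hf, ⟨hφ.isMomentumMap.smooth, fun ξ x v => ?_⟩,
    fun g x => ?_⟩, fun ξ x => ?_⟩
  · refine Eq.trans ?_ (hφ.isMomentumMap.contraction_eq ξ x v)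
    have h := congrArg (fun u : E => (Ω x : E [⋀^Fin 2]→L[ℝ] ℝ) ![u, v]) (hgen' ξ x)
    exact h.trans (alternating_sub_smul (E := E) (Ω x) ((hM.reebField_spec x).1 v) _ _)
  · exact (hφ.isMomentumMap.apply_flow_eq (F := F) hM hΦ _ _).trans (hφ.equivariant g x)
  · have h := congrArg (η x : E →L[ℝ] ℝ) (hgen' ξ x)
    refine h.trans ?_
    refine (map_sub (η x : E →L[ℝ] ℝ) _ _).trans (sub_eq_zero.2 ?_)
    refine Eq.trans (hgen ξ x) ?_
    refine Eq.trans ?_ (map_smul (η x : E →L[ℝ] ℝ) _ _).symm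
    have h1 : leftInvariantForm (etaCocycle (F := F) η φ) 1 ξ = etaCocycle η φ ξ :=
      DFunLike.congr_fun (leftInvariantForm_one (F := F) _) ξ
    -- The two contributions agree: `c_η(ξ) = c_η(ξ) · η(R)`.
    exact (mul_one _).symm.trans
      (congrArg₂ (fun a b : ℝ => a * b) h1.symm (hM.reebField_spec x).2.symm)
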